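/- Let $n\ge 1$ be an integer, $1\le p,q\le\infty$, $s\in\mathbf R$ and $0\le\alpha\le 2$. Write $\widehat f(\xi)=\int_{\mathbf R^n}f(x)e^{-ix\cdot\xi}\,dx$ for the Fourier transform, with inverse $f^\vee(x)=(2\pi)^{-n}\widehat f(-x)$, and $\langle k\rangle=(1+|k|^2)^{1/2}$. Let $\varphi\in\mathcal S(\mathbf R^n)$ be any (complex-valued) Schwartz function with $\operatorname{supp}\varphi\subset[-1,1]^n$ and $\sum_{k\in\mathbf Z^n}\varphi(\xi-k)=1$ for all $\xi\in\mathbf R^n$. The modulation space $M^{p,q}_s(\mathbf R^n)$ is the set of tempered distributions $f\in\mathcal S'(\mathbf R^n)$ for which $$\|f\|_{M^{p,q}_s}=\Big(\sum_{k\in\mathbf Z^n}\langle k\rangle^{sq}\,\big\|(\varphi(\cdot-k)\widehat f\,)^\vee\big\|_{L^p(\mathbf R^n)}^q\Big)^{1/q}$$ is finite (with the supremum over $k$ if $q=\infty$, and with $\|u\|_{L^p}=\infty$ if $u$ is not an $L^p$ function). For $f\in\mathcal S(\mathbf R^n)$ put $$e^{i|D|^\alpha}f(x)=(2\pi)^{-n}\int_{\mathbf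 R^n}e^{i|\xi|^\alpha}\widehat f(\xi)\,e^{ix\cdot\xi}\,d\xi .$$ Then the following are equivalent: 1. $e^{i|D|^\alpha}$ is bounded from $M^{p,q}_s(\mathbf R^n)$ to $L^p(\mathbf R^n)$, that is, there is a constant $C$ such that $\|e^{i|D|^\alpha}f\|_{L^p}\le C\|f\|_{M^{p,q}_s}$ for all $f\in\mathcal S(\mathbf R^n)$; 2. $M^{p,q}_s(\mathbf R^n)\hookrightarrow L^p(\mathbf R^n)$, that is, there is a constant $C$ such that every $f\in M^{p,q}_s(\mathbf R^n)$ belongs to $L^p(\mathbf R^n)$ and satisfies $\|f\|_{L^p}\le C\|f\|_{M^{p,q}_s}$. -/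

import Mathlib

open MeasureTheory FourierTransform
open scoped ENNReal NNReal SchwartzMap

noncomputable section

namespace ModulationSpace

/-- Euclidean space `ℝⁿ`. -/
abbrev Rn (n : ℕ) : Type := EuclideanSpace ℝ (Fin n)

/-- The lattice point `k ∈ ℤⁿ`, as a vector of `ℝⁿ`. -/
def latticePt {n : ℕ} (k : Fin n → ℤ) : Rn n :=
  WithLp.toLp 2 (fun i => (k i : ℝ))

/-- The windows used to define modulation spaces: Schwartz functions `φ` supported in the cube
`[-1, 1]ⁿ` whose integer translates sum to one. -/
structure IsWindow {n : ℕ} (φ : 𝓢(Rn n, ℂ)) : Prop where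
  tsupport_subset : tsupport φ ⊆ {ξ | ∀ i, |ξ i| ≤ 1}
  hasSum_translates : ∀ ξ : Rn n, HasSum (fun k : Fin n → ℤ => φ (ξ - latticePt k)) 1

/-- The `L^p` norm of a tempered distribution: the norm of the (unique) `L^p` function representing
it, and `∞` if there is none. -/
def distLpNorm {n : ℕ} (p : ℝ≥0∞) [Fact (1 ≤ p)] (u : 𝓢'(Rn n, ℂ)) : ℝ≥0∞ :=
  ⨅ (g : Lp ℂ p (volume : Measure (Rn n))) (_ : (g : 𝓢'(Rn n, ℂ)) = u), ‖g‖ₑ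

/-- The operator `φ(D - k) f = (φ(· - k) f̂)^∨`, where `f̂(ξ) = ∫ f(x) e^{-i x·ξ} dx`.
Mathlib's Fourier transform is `𝓕 f (η) = f̂(2πη)`, so that a symbol `σ(ξ)` becomes `σ(2πη)`. -/
def freqBlock {n : ℕ} (φ : 𝓢(Rn n, ℂ)) (k : Fin n → ℤ) (f : 𝓢'(Rn n, ℂ)) : 𝓢'(Rn n, ℂ) :=
  TemperedDistribution.fourierMultiplierCLM ℂ
    (fun η : Rn n => φ ((2 * Real.pi) • η - latticePt k)) f

/-- The weighted size `⟨k⟩^s ‖φ(D - k) f‖_{L^p}` of a frequency block, `⟨k⟩ = (1 + |k|²)^{1/2}`. -/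
def blockNorm {n : ℕ} (φ : 𝓢(Rn n, ℂ)) (p : ℝ≥0∞) [Fact (1 ≤ p)] (s : ℝ)
    (f : 𝓢'(Rn n, ℂ)) (k : Fin n → ℤ) : ℝ≥0∞ :=
  ENNReal.ofReal ((1 + ‖latticePt k‖ ^ 2) ^ (s / 2)) * distLpNorm p (freqBlock φ k f)

/-- The modulation space norm `‖f‖_{M^{p,q}_s}`, computed with the window `φ`. -/
def modNorm {n : ℕ} (φ : 𝓢(Rn n, ℂ)) (p q : ℝ≥0∞) [Fact (1 ≤ p)] (s : ℝ)
    (f : 𝓢'(Rn n, ℂ)) : ℝ≥0∞ :=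
  if q = ∞ then ⨆ k : Fin n → ℤ, blockNorm φ p s f k
  else (∑' k : Fin n → ℤ, blockNorm φ p s f k ^ q.toReal) ^ (1 / q.toReal)

/-- The modulation space `M^{p,q}_s(ℝⁿ)`. -/
def modSpace {n : ℕ} (φ : 𝓢(Rn n, ℂ)) (p q : ℝ≥0∞) [Fact (1 ≤ p)] (s : ℝ) :
    Set 𝓢'(Rn n, ℂ) :=
  {f | modNorm φ p q s f < ∞}

/-- The continuous embedding `M^{p,q}_s(ℝⁿ) ↪ L^p(ℝⁿ)`. -/
def ModEmbedsLp {n : ℕ} (φ : 𝓢(Rn n, ℂ)) (p q : ℝ≥0∞) [Fact (1 ≤ p)] (s : ℝ) : Prop :=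
  ∃ C : ℝ≥0, ∀ f ∈ modSpace φ p q s,
    ∃ g : Lp ℂ p (volume : Measure (Rn n)),
      (g : 𝓢'(Rn n, ℂ)) = f ∧ ‖g‖ₑ ≤ C * modNorm φ p q s f

/-- The unimodular Fourier multiplier
`e^{i|D|^α} f (x) = (2π)^{-n} ∫ e^{i|ξ|^α} f̂(ξ) e^{i x·ξ} dξ` on Schwartz functions, written with
Mathlib's Fourier transform (`ξ = 2πη`). -/
def expMultiplier {n : ℕ} (α : ℝ) (f : 𝓢(Rn n, ℂ)) : Rn n → ℂ :=
  𝓕⁻ (fun η : Rn n =>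
    Complex.exp (Complex.I * ((‖(2 * Real.pi) • η‖ ^ α : ℝ) : ℂ)) * 𝓕 (f : Rn n → ℂ) η)

/-- `e^{i|D|^α}` is bounded from `M^{p,q}_s(ℝⁿ)` to `L^p(ℝⁿ)`: the norm inequality holds on the
Schwartz space. -/
def ExpMultiplierBounded {n : ℕ} (φ : 𝓢(Rn n, ℂ)) (α : ℝ) (p q : ℝ≥0∞) [Fact (1 ≤ p)]
    (s : ℝ) : Prop :=
  ∃ C : ℝ≥0, ∀ f : 𝓢(Rn n, ℂ),
    eLpNorm (expMultiplier α f) p volume ≤ C * modNorm φ p q s (f : 𝓢'(Rn n, ℂ))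

end ModulationSpace

end

/-! Both statements are equivalent to `SchwartzEmbedsLp`, the inequality `‖g‖_p ≤ C ‖g‖_{M^{p,q}_s}`
for Schwartz `g`.

Operator side. The modulation norm treats each frequency cube `k + [-1, 1]ⁿ` separately, so it is
enough to bound `exp(±i(δ² + |D|²)^(α/2))` on functions with spectrum in one cube, uniformly in `k`
and `δ ∈ (0, 1]`; this is `exists_isLocalMultiplier_exp_regSq`. For large `|k|` expand the phase
about `k`: the part affine in `ξ` is a translation times a unimodular constant and costs nothing,
and what remains is bounded because `α ≤ 2` keeps the second derivatives of the phase bounded. For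
moderate `|k|` the phase itself is a bounded multiplier, uniformly in `δ`, although `|ξ|^α` may be
singular at the origin. These bounds come from power series in the algebra of local multipliers, not
from differentiating symbols. The shift by `δ²` makes the symbols smooth, so the operators preserve
`𝓢` and change the modulation norm by at most a constant factor (`modNorm_regPhase_le`). Letting `δ
→ 0` with Fatou's lemma relates the bound for `e^{i|D|^α}` to the bound for the identity.

Function side. Restricting the embedding to `𝓢` is immediate. In the converse direction density of
`𝓢` is not available when `p` or `q` is infinite, so the frequency blocks of `f` are shown to be
summable in `L^p`. If `p < ∞` and they were not, there would be infinitely many disjoint finite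
groups of blocks with `L^p` norm bounded below. Translating a group does not change its block norms,
and for groups moved far apart the `p`-th powers of the norms essentially add up, contradicting the
uniform bound (`summable_of_isBlockSum_bounded`). If `p = ∞`, test functions whose blocks all peak
at the origin turn the inequality into an `ℓ¹` bound by a weighted `ℓ^q` norm, whence absolute
convergence (`SchwartzEmbedsLp.exists_sum_le_of_top`). The sum of the blocks is `f` because the
windows form a partition of unity (`coe_tsum_lp_blocks`). -/

namespace ModulationSpace

open Filter Topology

/-! ### Young's inequality for multipliers with integrable kernel -/

section Young

variable {V : Type*} [NormedAddCommGroup V] [InnerProductSpace ℝ V] [FiniteDimensional ℝ V]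
  [MeasurableSpace V] [BorelSpace V]

/-- Minkowski-type estimate behind Young's inequality, in `lintegral` form. -/
theorem eLpNorm_lintegral_translate_le {p : ℝ≥0∞} (hp : 1 ≤ p) {K v : V → ℂ}
    (hK : Measurable K) (hKi : Integrable K) (hv : Measurable v) {g : V → ℂ}
    (hg : ∀ x, ‖g x‖ₑ ≤ ∫⁻ y, ‖K y‖ₑ * ‖v (x - y)‖ₑ) :
    eLpNorm g p volume ≤ (∫⁻ y, ‖K y‖ₑ) * eLpNorm v p volume := by
  set M := ∫⁻ y, ‖K y‖ₑ with hM
  have hMtop : M ≠ ∞ := hKi.2.ne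
  rcases eq_or_ne p ∞ with rfl | hp'
  · rw [eLpNorm_exponent_top, eLpNorm_exponent_top]
    refine eLpNormEssSup_le_of_ae_enorm_bound (ae_of_all _ fun x => (hg x).trans ?_)
    rw [hM, ← lintegral_mul_const _ hK.enorm]
    refine lintegral_mono_ae ?_
    have h1 : ∀ᵐ y : V, ‖v y‖ₑ ≤ eLpNormEssSup v volume := enorm_ae_le_eLpNormEssSup v _
    have h2 := (Measure.measurePreserving_sub_left (volume : Measure V) x).quasiMeasurePreserving.ae h1
    filter_upwards [h2] with y hy
    gcongr
  have hp0 : p ≠ 0 := (zero_lt_one.trans_le hp).ne'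
  have hr : 1 ≤ p.toReal := by
    rw [← ENNReal.toReal_one]; exact ENNReal.toReal_mono hp' hp
  have hr0 : 0 < p.toReal := by linarith
  -- Jensen's inequality for the measure `‖K y‖ dy`, whose total mass is `M`; Tonelli and
  -- translation invariance then finish.
  have key : ∀ x, ‖g x‖ₑ ^ p.toReal ≤
      (∫⁻ y, ‖K y‖ₑ * ‖v (x - y)‖ₑ ^ p.toReal) * M ^ (p.toReal - 1) := by
    intro x
    set ν := (volume : Measure V).withDensity (fun y => ‖K y‖ₑ) with hν
    have hvx : Measurable fun y => v (x - y) := hv.comp (measurable_const.sub measurable_id)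
    have h1 := eLpNorm_le_eLpNorm_mul_rpow_measure_univ (μ := ν) (f := fun y => v (x - y)) hp
      hvx.aestronglyMeasurable
    have hνu : ν Set.univ = M := by simp [hν, hM]
    rw [hνu, eLpNorm_one_eq_lintegral_enorm, eLpNorm_eq_lintegral_rpow_enorm_toReal hp0 hp', hν,
      lintegral_withDensity_eq_lintegral_mul _ hK.enorm hvx.enorm,
      lintegral_withDensity_eq_lintegral_mul _ hK.enorm (hvx.enorm.pow_const _)] at h1
    have h2 := ENNReal.rpow_le_rpow ((hg x).trans h1) hr0.le
    refine h2.trans (le_of_eq ?_)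
    rw [ENNReal.mul_rpow_of_nonneg _ _ hr0.le, ← ENNReal.rpow_mul, ← ENNReal.rpow_mul]
    congr 1
    · rw [one_div, inv_mul_cancel₀ hr0.ne', ENNReal.rpow_one]; rfl
    · congr 1; simp; field_simp
  rw [eLpNorm_eq_lintegral_rpow_enorm_toReal hp0 hp', eLpNorm_eq_lintegral_rpow_enorm_toReal hp0 hp']
  have hmeas : Measurable (fun q : V × V => ‖K q.2‖ₑ * ‖v (q.1 - q.2)‖ₑ ^ p.toReal) :=
    (hK.comp measurable_snd).enorm.mul
      ((hv.comp (measurable_fst.sub measurable_snd)).enorm.pow_const _)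
  have h3 : ∫⁻ x, ‖g x‖ₑ ^ p.toReal ≤ M ^ p.toReal * ∫⁻ x, ‖v x‖ₑ ^ p.toReal := by
    calc ∫⁻ x, ‖g x‖ₑ ^ p.toReal
        ≤ ∫⁻ x, (∫⁻ y, ‖K y‖ₑ * ‖v (x - y)‖ₑ ^ p.toReal) * M ^ (p.toReal - 1) :=
          lintegral_mono key
      _ = (∫⁻ x, ∫⁻ y, ‖K y‖ₑ * ‖v (x - y)‖ₑ ^ p.toReal) * M ^ (p.toReal - 1) :=
          lintegral_mul_const _ hmeas.lintegral_prod_right'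
      _ = (∫⁻ y, ∫⁻ x, ‖K y‖ₑ * ‖v (x - y)‖ₑ ^ p.toReal) * M ^ (p.toReal - 1) := by
          rw [lintegral_lintegral_swap hmeas.aemeasurable]
      _ = (M * ∫⁻ x, ‖v x‖ₑ ^ p.toReal) * M ^ (p.toReal - 1) := by
          congr 1
          rw [hM, ← lintegral_mul_const _ hK.enorm]
          refine lintegral_congr fun y => ?_
          rw [lintegral_const_mul _ (by fun_prop)]
          congr 1
          exact lintegral_sub_right_eq_self (fun x => ‖v x‖ₑ ^ p.toReal) y
      _ = _ := by
          rw [mul_right_comm]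
          congr 1
          rcases eq_or_ne M 0 with h0 | h0
          · simp [h0, hr0]
          · nth_rewrite 1 [← ENNReal.rpow_one M]
            rw [← ENNReal.rpow_add _ _ h0 hMtop]; simp
  refine (ENNReal.rpow_le_rpow h3 (by positivity)).trans (le_of_eq ?_)
  rw [ENNReal.mul_rpow_of_nonneg _ _ (by positivity), ← ENNReal.rpow_mul, mul_one_div,
    div_self hr0.ne', ENNReal.rpow_one]

/-- Fubini alone gives this, since `K ⊗ w` is integrable; no integrability of `𝓕⁻ w` is required. -/
theorem fourierInv_fourier_mul {K w : V → ℂ} (hK : Integrable K) (hw : Integrable w) (x : V) :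
    𝓕⁻ (fun η => 𝓕 K η * w η) x = ∫ y, K y * 𝓕⁻ w (x - y) := by
  simp only [Real.fourierInv_eq', Real.fourier_eq', smul_eq_mul]
  have h1 : ∀ η : V, Complex.exp (↑(2 * Real.pi * inner ℝ η x) * Complex.I) *
      ((∫ y, Complex.exp (↑(-2 * Real.pi * inner ℝ y η) * Complex.I) * K y) * w η)
      = ∫ y, K y * (Complex.exp (↑(2 * Real.pi * inner ℝ η (x - y)) * Complex.I) * w η) := by
    intro η
    rw [← integral_mul_const, ← integral_const_mul]
    refine integral_congr_ae (ae_of_all _ fun y => ?_)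
    have : Complex.exp (↑(2 * Real.pi * inner ℝ η (x - y)) * Complex.I) =
        Complex.exp (↑(2 * Real.pi * inner ℝ η x) * Complex.I) *
        Complex.exp (↑(-2 * Real.pi * inner ℝ y η) * Complex.I) := by
      rw [← Complex.exp_add, inner_sub_right, real_inner_comm η y]
      congr 1; push_cast; ring
    simp only [this]
    ring
  simp only [h1, ← integral_const_mul]
  rw [integral_integral_swap]
  have h3 : Integrable (fun q : V × V => w q.1 * K q.2) (volume.prod volume) := hw.mul_prod hK
  refine (h3.bdd_mul (c := 1) (f := fun q : V × V =>
    Complex.exp (↑(2 * Real.pi * inner ℝ q.1 (x - q.2)) * Complex.I))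
    (by fun_prop) (ae_of_all _ fun q => (Complex.norm_exp_ofReal_mul_I _).le)).congr ?_
  refine ae_of_all _ fun q => ?_
  simp only [Function.uncurry_def]
  ring

theorem continuous_fourierInv {w : V → ℂ} (hw : Integrable w) : Continuous (𝓕⁻ w) := by
  rw [Real.fourierInv_eq_fourier_comp_neg]
  exact VectorFourier.fourierIntegral_continuous Real.continuous_fourierChar
    (by exact continuous_inner) hw.comp_neg

/-- Young's inequality for the Fourier multiplier with symbol `𝓕 K`, `K ∈ L¹`. -/
theorem eLpNorm_fourierInv_fourier_mul_le {p : ℝ≥0∞} (hp : 1 ≤ p) {K w : V → ℂ}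
    (hKm : Measurable K) (hK : Integrable K) (hw : Integrable w) :
    eLpNorm (𝓕⁻ (fun η => 𝓕 K η * w η)) p volume
      ≤ (∫⁻ y, ‖K y‖ₑ) * eLpNorm (𝓕⁻ w) p volume := by
  refine eLpNorm_lintegral_translate_le hp hKm hK (continuous_fourierInv hw).measurable fun x => ?_
  rw [fourierInv_fourier_mul hK hw]
  refine (enorm_integral_le_lintegral_enorm _).trans (le_of_eq ?_)
  simp [enorm_mul]

end Young

/-! ### The algebra of frequency-localised `L^p` multipliers -/

section Calculus

variable {V : Type*} [NormedAddCommGroup V] [InnerProductSpace ℝ V] [FiniteDimensional ℝ V]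
  [MeasurableSpace V] [BorelSpace V]

/-- `a` acts as a Fourier multiplier with `L^p` norm at most `B` on the functions whose Fourier
transform is integrable and vanishes outside `S`. -/
structure IsLocalMultiplier (p : ℝ≥0∞) (S : Set V) (a : V → ℂ) (B : ℝ≥0) : Prop where
  measurable : Measurable a
  nnnorm_le : ∀ η ∈ S, ‖a η‖₊ ≤ B
  eLpNorm_le : ∀ w : V → ℂ, Integrable w → (∀ η, η ∉ S → w η = 0) →
    eLpNorm (𝓕⁻ (fun η => a η * w η)) p volume ≤ B * eLpNorm (𝓕⁻ w) p volume

namespace IsLocalMultiplier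

variable {p : ℝ≥0∞} {S T : Set V} {a b : V → ℂ} {A B : ℝ≥0}

/-- The sup bound on `S` keeps spectra integrable, so that multipliers can be composed; it also
yields the pointwise convergence of power series in `a`. -/
theorem integrable_mul (h : IsLocalMultiplier p S a A) {w : V → ℂ} (hw : Integrable w)
    (hwS : ∀ η, η ∉ S → w η = 0) : Integrable fun η => a η * w η := by
  refine (hw.norm.const_mul (A : ℝ)).mono'
    (h.measurable.aestronglyMeasurable.mul hw.aestronglyMeasurable) (ae_of_all _ fun η => ?_)
  by_cases hη : η ∈ S
  · rw [norm_mul]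
    exact mul_le_mul_of_nonneg_right (h.nnnorm_le η hη) (norm_nonneg _)
  · simp [hwS η hη]

theorem mono (h : IsLocalMultiplier p S a A) (hST : T ⊆ S) (hAB : A ≤ B) :
    IsLocalMultiplier p T a B where
  measurable := h.measurable
  nnnorm_le η hη := (h.nnnorm_le η (hST hη)).trans hAB
  eLpNorm_le w hw hwT := (h.eLpNorm_le w hw fun η hη => hwT η fun h' => hη (hST h')).trans (by gcongr)

theorem mono_set (h : IsLocalMultiplier p S a A) (hST : T ⊆ S) : IsLocalMultiplier p T a A :=
  h.mono hST le_rfl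

theorem mono_bound (h : IsLocalMultiplier p S a A) (hAB : A ≤ B) : IsLocalMultiplier p S a B :=
  h.mono le_rfl hAB

theorem congr (h : IsLocalMultiplier p S a A) (hb : Measurable b) (hab : ∀ η ∈ S, b η = a η) :
    IsLocalMultiplier p S b A where
  measurable := hb
  nnnorm_le η hη := by rw [hab η hη]; exact h.nnnorm_le η hη
  eLpNorm_le w hw hwS := by
    have : (fun η => b η * w η) = fun η => a η * w η := by
      ext η
      by_cases hη : η ∈ S
      · rw [hab η hη]
      · simp [hwS η hη]
    rw [this]; exact h.eLpNorm_le w hw hwS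

theorem const (c : ℂ) : IsLocalMultiplier p S (fun _ => c) ‖c‖₊ where
  measurable := measurable_const
  nnnorm_le _ _ := le_rfl
  eLpNorm_le w hw hwS := by
    have : 𝓕⁻ (fun η => c * w η) = c • 𝓕⁻ w := by
      ext x
      simp only [Real.fourierInv_eq', smul_eq_mul, Pi.smul_apply, ← integral_const_mul]
      congr 1; ext η; ring
    rw [this, eLpNorm_const_smul]; rfl

theorem mul (ha : IsLocalMultiplier p S a A) (hb : IsLocalMultiplier p S b B) :
    IsLocalMultiplier p S (fun η => a η * b η) (A * B) where
  measurable := ha.measurable.mul hb.measurable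
  nnnorm_le η hη := by
    rw [nnnorm_mul]; exact mul_le_mul' (ha.nnnorm_le η hη) (hb.nnnorm_le η hη)
  eLpNorm_le w hw hwS := by
    have h1 := ha.eLpNorm_le _ (hb.integrable_mul hw hwS) (fun η hη => by simp [hwS η hη])
    simp only [mul_assoc, ENNReal.coe_mul]
    exact h1.trans (mul_le_mul_right (hb.eLpNorm_le w hw hwS) _)

theorem const_mul (c : ℂ) (ha : IsLocalMultiplier p S a A) :
    IsLocalMultiplier p S (fun η => c * a η) (‖c‖₊ * A) :=
  (const c).mul ha

theorem add (hp : 1 ≤ p) (ha : IsLocalMultiplier p S a A) (hb : IsLocalMultiplier p S b B) :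
    IsLocalMultiplier p S (fun η => a η + b η) (A + B) where
  measurable := ha.measurable.add hb.measurable
  nnnorm_le η hη := (nnnorm_add_le _ _).trans (add_le_add (ha.nnnorm_le η hη) (hb.nnnorm_le η hη))
  eLpNorm_le w hw hwS := by
    have hia := ha.integrable_mul hw hwS
    have hib := hb.integrable_mul hw hwS
    have : 𝓕⁻ (fun η => (a η + b η) * w η)
        = 𝓕⁻ (fun η => a η * w η) + 𝓕⁻ (fun η => b η * w η) := by
      ext x
      have hx : ∀ u : V → ℂ, Integrable u →
          Integrable fun η => Complex.exp (↑(2 * Real.pi * inner ℝ η x) * Complex.I) * u η :=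
        fun u hu => hu.bdd_mul (c := 1) (by fun_prop)
          (ae_of_all _ fun q => (Complex.norm_exp_ofReal_mul_I _).le)
      simp only [Real.fourierInv_eq', smul_eq_mul, Pi.add_apply]
      rw [← integral_add (hx _ hia) (hx _ hib)]
      simp only [add_mul, mul_add]
    rw [this, ENNReal.coe_add, add_mul]
    exact (eLpNorm_add_le (continuous_fourierInv hia).aestronglyMeasurable
      (continuous_fourierInv hib).aestronglyMeasurable hp).trans
      (add_le_add (ha.eLpNorm_le w hw hwS) (hb.eLpNorm_le w hw hwS))

theorem sum (hp : 1 ≤ p) {ι : Type*} {s : Finset ι} {a : ι → V → ℂ} {A : ι → ℝ≥0}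
    (h : ∀ i ∈ s, IsLocalMultiplier p S (a i) (A i)) :
    IsLocalMultiplier p S (fun η => ∑ i ∈ s, a i η) (∑ i ∈ s, A i) := by
  classical
  induction s using Finset.induction_on with
  | empty => simpa using const (p := p) (S := S) 0
  | insert i s hi ih =>
    simp only [Finset.sum_insert hi]
    exact (h i (by simp)).add hp (ih fun j hj => h j (by simp [hj]))

theorem pow (ha : IsLocalMultiplier p S a A) (m : ℕ) :
    IsLocalMultiplier p S (fun η => a η ^ m) (A ^ m) := by
  induction m with
  | zero => simpa using const (p := p) (S := S) 1
  | succ m ih => simpa only [pow_succ] using ih.mul ha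

/-- Dominated convergence gives pointwise convergence of the inverse transforms, and Fatou's lemma
carries the `L^p` bound to the limit. This is what allows infinite series of multipliers. -/
theorem of_tendsto {a : ℕ → V → ℂ} {b : V → ℂ} (h : ∀ m, IsLocalMultiplier p S (a m) A)
    (hb : Measurable b) (hlim : ∀ η ∈ S, Tendsto (fun m => a m η) atTop (𝓝 (b η))) :
    IsLocalMultiplier p S b A where
  measurable := hb
  nnnorm_le η hη := le_of_tendsto (hlim η hη).nnnorm (Eventually.of_forall fun m =>
    (h m).nnnorm_le η hη)
  eLpNorm_le w hw hwS := by
    refine Lp.eLpNorm_le_of_ae_tendsto (u := atTop) (f := fun m => 𝓕⁻ (fun η => a m η * w η))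
      (Eventually.of_forall fun m => (h m).eLpNorm_le w hw hwS)
      (fun m => (continuous_fourierInv ((h m).integrable_mul hw hwS)).aestronglyMeasurable)
      (ae_of_all _ fun x => ?_)
    simp only [Real.fourierInv_eq', smul_eq_mul]
    refine tendsto_integral_of_dominated_convergence (fun η => A * ‖w η‖)
      (fun m => ?_) (hw.norm.const_mul _) (fun m => ae_of_all _ fun η => ?_)
      (ae_of_all _ fun η => ?_)
    · exact (by fun_prop : Continuous _).aestronglyMeasurable.mul
        ((h m).integrable_mul hw hwS).aestronglyMeasurable
    · rw [norm_mul, Complex.norm_exp_ofReal_mul_I, one_mul]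
      by_cases hη : η ∈ S
      · rw [norm_mul]
        exact mul_le_mul_of_nonneg_right ((h m).nnnorm_le η hη) (norm_nonneg _)
      · simp [hwS η hη]
    · by_cases hη : η ∈ S
      · exact ((hlim η hη).mul_const _).const_mul _
      · simp [hwS η hη]

theorem of_hasSum (hp : 1 ≤ p) {a : ℕ → V → ℂ} {A : ℕ → ℝ≥0}
    (h : ∀ m, IsLocalMultiplier p S (a m) (A m)) {b : V → ℂ} (hb : Measurable b)
    (hsum : ∀ η ∈ S, HasSum (fun m => a m η) (b η)) (hA : ∀ M, ∑ m ∈ Finset.range M, A m ≤ B) :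
    IsLocalMultiplier p S b B :=
  of_tendsto (a := fun M η => ∑ m ∈ Finset.range M, a m η)
    (fun M => (sum hp fun m _ => h m).mono_bound (hA M)) hb
    fun η hη => (hsum η hη).tendsto_sum_nat

/-- Power series functional calculus. -/
theorem powerSeries (hp : 1 ≤ p) (ha : IsLocalMultiplier p S a A) (c : ℕ → ℂ)
    {b : V → ℂ} (hb : Measurable b) (hsum : ∀ η ∈ S, HasSum (fun m => c m * a η ^ m) (b η))
    (hA : ∀ M, ∑ m ∈ Finset.range M, ‖c m‖₊ * A ^ m ≤ B) : IsLocalMultiplier p S b B :=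
  of_hasSum hp (fun m => (ha.pow m).const_mul (c m)) hb hsum hA

theorem exp (hp : 1 ≤ p) (ha : IsLocalMultiplier p S a A) :
    IsLocalMultiplier p S (fun η => Complex.exp (a η)) (Real.exp A).toNNReal := by
  refine ha.powerSeries hp (fun m => ((m.factorial : ℂ))⁻¹) (Complex.measurable_exp.comp ha.measurable)
    (fun η _ => ?_) fun M => ?_
  · have := NormedSpace.expSeries_div_hasSum_exp (a η)
    rw [← Complex.exp_eq_exp_ℂ] at this
    simpa [div_eq_inv_mul] using this
  · rw [← NNReal.coe_le_coe, Real.coe_toNNReal _ (Real.exp_pos _).le]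
    push_cast
    refine le_trans (le_of_eq ?_) (Real.sum_le_exp_of_nonneg A.2 M)
    refine Finset.sum_congr rfl fun m _ => ?_
    simp [div_eq_inv_mul]

theorem of_fourier (hp : 1 ≤ p) {K : V → ℂ} (hK : Measurable K) (hKi : Integrable K) :
    IsLocalMultiplier p S (𝓕 K) (∫⁻ y, ‖K y‖ₑ).toNNReal where
  measurable := (VectorFourier.fourierIntegral_continuous Real.continuous_fourierChar
    (by exact continuous_inner) hKi).measurable
  nnnorm_le η _ := by
    have h := VectorFourier.norm_fourierIntegral_le_integral_norm Real.fourierChar volume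
      (innerₗ V) K η
    rw [← NNReal.coe_le_coe]
    refine h.trans (le_of_eq ?_)
    rw [integral_norm_eq_lintegral_enorm hKi.aestronglyMeasurable]; rfl
  eLpNorm_le w hw _ := by
    rw [ENNReal.coe_toNNReal hKi.2.ne]
    exact eLpNorm_fourierInv_fourier_mul_le hp hK hKi hw

/-- Modulations are isometric multipliers. -/
theorem exp_inner (p : ℝ≥0∞) (S : Set V) (c : ℝ) (b : V) :
    IsLocalMultiplier p S (fun η => Complex.exp (Complex.I * ((c + inner ℝ η b : ℝ) : ℂ))) 1 where
  measurable := (by fun_prop : Continuous _).measurable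
  nnnorm_le η _ := by
    rw [← NNReal.coe_le_coe, coe_nnnorm, mul_comm, Complex.norm_exp_ofReal_mul_I]; rfl
  eLpNorm_le w hw _ := by
    have : 𝓕⁻ (fun η => Complex.exp (Complex.I * ((c + inner ℝ η b : ℝ) : ℂ)) * w η)
        = Complex.exp (c * Complex.I) • (𝓕⁻ w ∘ fun x => x + (2 * Real.pi)⁻¹ • b) := by
      ext x
      simp only [Real.fourierInv_eq', smul_eq_mul, Pi.smul_apply, Function.comp,
        ← integral_const_mul]
      refine integral_congr_ae (ae_of_all _ fun η => ?_)
      simp only [← mul_assoc, ← Complex.exp_add]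
      congr 2
      rw [inner_add_right, inner_smul_right]
      push_cast
      field_simp
      ring
    rw [this, eLpNorm_const_smul, eLpNorm_comp_measurePreserving
      (continuous_fourierInv hw).aestronglyMeasurable (measurePreserving_add_right _ _)]
    rw [← ofReal_norm, Complex.norm_exp_ofReal_mul_I]
    simp

/-- Translation covariance in frequency. -/
theorem translate (h : IsLocalMultiplier p S a A) (c : V) :
    IsLocalMultiplier p {η | η - c ∈ S} (fun η => a (η - c)) A where
  measurable := h.measurable.comp (measurable_id.sub_const c)
  nnnorm_le η hη := h.nnnorm_le _ hη
  eLpNorm_le w hw hwS := by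
    -- Shifting the spectrum multiplies the function by a unimodular character, which no `L^p` norm
    -- sees.
    have key : ∀ u : V → ℂ, Integrable u →
        eLpNorm (𝓕⁻ u) p volume = eLpNorm (𝓕⁻ fun η => u (η + c)) p volume := by
      intro u hu
      refine eLpNorm_congr_norm_ae (ae_of_all _ fun x => ?_)
      have : 𝓕⁻ u x = Complex.exp (↑(2 * Real.pi * inner ℝ c x) * Complex.I) *
          𝓕⁻ (fun η => u (η + c)) x := by
        simp only [Real.fourierInv_eq', smul_eq_mul, ← integral_const_mul]
        rw [← integral_add_right_eq_self _ c]
        refine integral_congr_ae (ae_of_all _ fun η => ?_)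
        simp only [← mul_assoc, ← Complex.exp_add]
        congr 2
        rw [inner_add_left]
        push_cast
        ring
      rw [this, norm_mul, Complex.norm_exp_ofReal_mul_I, one_mul]
    have hw' : Integrable fun η => w (η + c) := hw.comp_add_right c
    have h0 : ∀ η, η ∉ S → w (η + c) = 0 := fun η hη => hwS _ (by simpa using hη)
    have hi : Integrable fun η => a (η - c) * w η := by
      simpa using (h.integrable_mul hw' h0).comp_sub_right c
    rw [key _ hi, key _ hw]
    simpa using h.eLpNorm_le _ hw' h0

end IsLocalMultiplier

end Calculus

/-! ### Size and sign of generalised binomial coefficients -/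

section Binomial

theorem hasSum_one_add_rpow (β : ℝ) {x : ℝ} (hx : |x| < 1) :
    HasSum (fun m : ℕ => Ring.choose β m * x ^ m) ((1 + x) ^ β) := by
  have h := (Real.one_add_rpow_hasFPowerSeriesOnBall_zero (a := β)).hasSum (y := x)
    (by simpa [← ofReal_norm] using hx)
  rw [zero_add] at h
  refine h.congr_fun fun m => ?_
  rw [binomialSeries_apply]
  simp

theorem succ_mul_choose_succ (β : ℝ) (m : ℕ) :
    ((m : ℝ) + 1) * Ring.choose β (m + 1) = Ring.choose β m * (β - m) := by
  have h := Ring.choose_smul_choose β (Nat.le_succ m)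
  simpa [Nat.succ_eq_add_one] using h

/-- Consecutive coefficients have ratio `(β - m)/(m + 1)`, of modulus at most one in this range of
`β`. -/
theorem abs_choose_le_one {β : ℝ} (h0 : -1 ≤ β) (h1 : β ≤ 1) (m : ℕ) : |Ring.choose β m| ≤ 1 := by
  induction m with
  | zero => simp
  | succ m ih =>
    have h := congrArg abs (succ_mul_choose_succ β m)
    have hm : (0 : ℝ) ≤ m := m.cast_nonneg
    rw [abs_mul, abs_mul, abs_of_pos (by positivity : (0 : ℝ) < (m : ℝ) + 1)] at h
    have h2 : |β - m| ≤ m + 1 := abs_le.2 ⟨by linarith, by linarith⟩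
    have h3 : |Ring.choose β m| * |β - m| ≤ 1 * (m + 1) :=
      mul_le_mul ih h2 (abs_nonneg _) zero_le_one
    rw [← h] at h3
    exact le_of_mul_le_mul_left (by linarith) (by positivity : (0 : ℝ) < (m : ℝ) + 1)

/-- These are the nonconstant coefficients of `(1 - x)^β`: the first is `-β`, and each is the
previous one times `(m + 1 - β)/(m + 2) ≥ 0`. -/
theorem neg_one_pow_mul_choose_succ_nonpos {β : ℝ} (h0 : 0 ≤ β) (h1 : β ≤ 1) (m : ℕ) :
    (-1) ^ (m + 1) * Ring.choose β (m + 1) ≤ 0 := by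
  induction m with
  | zero => simpa using h0
  | succ m ih =>
    have h := succ_mul_choose_succ β (m + 1)
    have hm : (0 : ℝ) ≤ m := m.cast_nonneg
    have h2 : ((m + 1 : ℕ) + 1 : ℝ) * ((-1) ^ (m + 2) * Ring.choose β (m + 2))
        = ((-1) ^ (m + 1) * Ring.choose β (m + 1)) * (m + 1 - β) := by
      rw [show ((m + 1 : ℕ) + 1 : ℝ) * ((-1) ^ (m + 2) * Ring.choose β (m + 2))
        = (-1) ^ (m + 2) * (((m + 1 : ℕ) + 1 : ℝ) * Ring.choose β (m + 2)) by ring, h]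
      push_cast; ring
    have h3 := mul_nonpos_of_nonpos_of_nonneg ih (by linarith : (0 : ℝ) ≤ m + 1 - β)
    rw [← h2] at h3
    by_contra hc
    push Not at hc
    exact absurd h3 (not_le.2 (mul_pos (by positivity) hc))

/-- The binomial series of `(1 - x)^β`, `0 ≤ β ≤ 1`, converges absolutely at the boundary. -/
theorem sum_abs_choose_le {β : ℝ} (h0 : 0 ≤ β) (h1 : β ≤ 1) (M : ℕ) :
    ∑ m ∈ Finset.range M, |Ring.choose β m| ≤ 2 := by
  have habs : ∀ m, |Ring.choose β (m + 1)| = -((-1) ^ (m + 1) * Ring.choose β (m + 1)) := by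
    intro m
    rw [← abs_of_nonpos (neg_one_pow_mul_choose_succ_nonpos h0 h1 m), abs_mul]; simp
  -- As the nonconstant coefficients share one sign, their absolute series at `x` sums to `1 - (1 -
  -- x)^β ≤ 1`. Finite partial sums survive `x ↑ 1`, and the constant term accounts for the other
  -- unit in the bound 2.
  have key : ∀ x : ℝ, 0 ≤ x → x < 1 → ∑ m ∈ Finset.range M, |Ring.choose β (m + 1)| * x ^ (m + 1) ≤ 1 := by
    intro x hx0 hx1
    have hs := hasSum_one_add_rpow β (x := -x) (by rw [abs_neg, abs_of_nonneg hx0]; exact hx1)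
    rw [← hasSum_nat_add_iff' 1] at hs
    have hs' := hs.neg
    have h3 : ∀ m : ℕ, -(Ring.choose β (m + 1) * (-x) ^ (m + 1))
        = |Ring.choose β (m + 1)| * x ^ (m + 1) := by
      intro m; rw [habs, neg_pow x]; ring
    simp only [h3] at hs'
    have h4 := sum_le_hasSum (Finset.range M) (fun m _ => by positivity) hs'
    refine h4.trans ?_
    have h5 : (0 : ℝ) ≤ (1 + -x) ^ β := Real.rpow_nonneg (by linarith) _
    simp only [Finset.range_one, Finset.sum_singleton, Ring.choose_zero_right, pow_zero, mul_one]
    linarith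
  have hlim : Tendsto (fun x : ℝ => ∑ m ∈ Finset.range M, |Ring.choose β (m + 1)| * x ^ (m + 1))
      (𝓝[<] 1) (𝓝 (∑ m ∈ Finset.range M, |Ring.choose β (m + 1)| * 1 ^ (m + 1))) :=
    (by fun_prop : Continuous fun x : ℝ =>
      ∑ m ∈ Finset.range M, |Ring.choose β (m + 1)| * x ^ (m + 1)).tendsto 1 |>.mono_left
        nhdsWithin_le_nhds
  have hle := le_of_tendsto hlim (by
    filter_upwards [Ioo_mem_nhdsLT (zero_lt_one (α := ℝ))] with x hx using key x hx.1.le hx.2)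
  simp only [one_pow, mul_one] at hle
  calc ∑ m ∈ Finset.range M, |Ring.choose β m| ≤ ∑ m ∈ Finset.range (M + 1), |Ring.choose β m| :=
        Finset.sum_le_sum_of_subset_of_nonneg (by simp) (fun _ _ _ => abs_nonneg _)
    _ ≤ 2 := by rw [Finset.sum_range_succ']; simp; linarith

end Binomial

/-! ### Binomial functional calculus for multipliers -/

namespace IsLocalMultiplier

variable {V : Type*} [NormedAddCommGroup V] [InnerProductSpace ℝ V] [FiniteDimensional ℝ V]
  [MeasurableSpace V] [BorelSpace V] {p : ℝ≥0∞} {S : Set V} {A : ℝ≥0}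

theorem abs_le {z : V → ℝ} (hz : IsLocalMultiplier p S (fun η => (z η : ℂ)) A) {η : V}
    (hη : η ∈ S) : |z η| ≤ A := by
  have h := hz.nnnorm_le η hη
  rw [← NNReal.coe_le_coe, coe_nnnorm, Complex.norm_real] at h
  exact h

theorem measurable_of_ofReal {z : V → ℝ} (hz : IsLocalMultiplier p S (fun η => (z η : ℂ)) A) :
    Measurable z := by
  have := Complex.measurable_re.comp hz.measurable
  exact this

theorem sum_geometric_le (hA : A ≤ 1 / 2) {c : ℕ → ℂ} (hc : ∀ m, ‖c m‖₊ ≤ 1) (M : ℕ) :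
    ∑ m ∈ Finset.range M, ‖c m‖₊ * A ^ m ≤ 2 := by
  calc ∑ m ∈ Finset.range M, ‖c m‖₊ * A ^ m ≤ ∑ m ∈ Finset.range M, (1 / 2 : ℝ≥0) ^ m :=
        Finset.sum_le_sum fun m _ => by
          calc ‖c m‖₊ * A ^ m ≤ 1 * (1 / 2) ^ m := by gcongr; exact hc m
            _ = _ := one_mul _
    _ ≤ ∑' m, (1 / 2 : ℝ≥0) ^ m := NNReal.summable_geometric (by
          rw [← NNReal.coe_lt_coe]; norm_num) |>.sum_le_tsum _ (fun _ _ => zero_le)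
    _ = 2 := by
      rw [NNReal.tsum_geometric (by rw [← NNReal.coe_lt_coe]; norm_num), ← NNReal.coe_inj,
        NNReal.coe_inv, NNReal.coe_sub (by rw [← NNReal.coe_le_coe]; norm_num)]
      norm_num

/-- Binomial functional calculus. -/
theorem one_add_rpow (hp : 1 ≤ p) {z : V → ℝ} (hz : IsLocalMultiplier p S (fun η => (z η : ℂ)) A)
    (hA : A ≤ 1 / 2) {β : ℝ} (h0 : -1 ≤ β) (h1 : β ≤ 1) :
    IsLocalMultiplier p S (fun η => (((1 + z η) ^ β : ℝ) : ℂ)) 2 := by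
  refine hz.powerSeries hp (fun m => ((Ring.choose β m : ℝ) : ℂ)) ?_ (fun η hη => ?_)
    (sum_geometric_le hA fun m => ?_)
  · exact Complex.measurable_ofReal.comp ((hz.measurable_of_ofReal.const_add 1).pow_const β)
  · have h2 : |z η| < 1 := (hz.abs_le hη).trans_lt
      (lt_of_le_of_lt (NNReal.coe_le_coe.2 hA) (by norm_num))
    exact_mod_cast Complex.hasSum_ofReal.2 (hasSum_one_add_rpow β h2)
  · rw [← NNReal.coe_le_coe, coe_nnnorm, Complex.norm_real]
    exact abs_choose_le_one h0 h1 m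

/-- Second order remainder in the binomial series. -/
theorem one_add_rpow_sub (hp : 1 ≤ p) {z : V → ℝ}
    (hz : IsLocalMultiplier p S (fun η => (z η : ℂ)) A)
    (hA : A ≤ 1 / 2) {β : ℝ} (h0 : -1 ≤ β) (h1 : β ≤ 1) :
    IsLocalMultiplier p S (fun η => (((1 + z η) ^ β - 1 - β * z η : ℝ) : ℂ)) (A ^ 2 * 2) := by
  have hq : ∀ η ∈ S, HasSum (fun m : ℕ => Ring.choose β (m + 2) * z η ^ (m + 2))
      ((1 + z η) ^ β - 1 - β * z η) := by
    intro η hη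
    have h2 : |z η| < 1 := (hz.abs_le hη).trans_lt
      (lt_of_le_of_lt (NNReal.coe_le_coe.2 hA) (by norm_num))
    have h3 := (hasSum_nat_add_iff' 2).2 (hasSum_one_add_rpow β h2)
    simp only [Finset.sum_range_succ, Finset.sum_range_zero, zero_add, pow_zero, pow_one,
      Ring.choose_zero_right, Ring.choose_one_right, mul_one] at h3
    rwa [← sub_sub] at h3
  have hm := hz.measurable_of_ofReal
  refine of_hasSum hp (a := fun m η => (Ring.choose β (m + 2) : ℂ) * ((z η : ℂ)) ^ (m + 2))
    (A := fun m => ‖(Ring.choose β (m + 2) : ℂ)‖₊ * A ^ (m + 2))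
    (fun m => (hz.pow (m + 2)).const_mul _) ?_ (fun η hη => ?_) (fun M => ?_)
  · exact Complex.measurable_ofReal.comp (((hm.const_add 1).pow_const β).sub_const 1 |>.sub
      (hm.const_mul β))
  · exact_mod_cast Complex.hasSum_ofReal.2 (hq η hη)
  · have h4 := sum_geometric_le hA (c := fun m => (Ring.choose β (m + 2) : ℂ)) (fun m => by
      rw [← NNReal.coe_le_coe, coe_nnnorm, ← Complex.ofReal_choose, Complex.norm_real]
      exact abs_choose_le_one h0 h1 _) M
    calc _ = A ^ 2 * ∑ m ∈ Finset.range M, ‖(Ring.choose β (m + 2) : ℂ)‖₊ * A ^ m := by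
          rw [Finset.mul_sum]; refine Finset.sum_congr rfl fun m _ => ?_; ring
      _ ≤ _ := by gcongr

/-- Fractional powers of `1 - P` for a power bounded `P`. -/
theorem one_sub_rpow (hp : 1 ≤ p) {P : V → ℝ}
    (hP : IsLocalMultiplier p S (fun η => (P η : ℂ)) 1) (hlt : ∀ η ∈ S, |P η| < 1)
    {β : ℝ} (h0 : 0 ≤ β) (h1 : β ≤ 1) :
    IsLocalMultiplier p S (fun η => (((1 - P η) ^ β : ℝ) : ℂ)) 2 := by
  refine hP.powerSeries hp (fun m => (((-1) ^ m * Ring.choose β m : ℝ) : ℂ)) ?_ (fun η hη => ?_)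
    (fun M => ?_)
  · exact Complex.measurable_ofReal.comp ((hP.measurable_of_ofReal.const_sub 1).pow_const β)
  · have h := hasSum_one_add_rpow β (x := -P η) (by rw [abs_neg]; exact hlt η hη)
    have h' := Complex.hasSum_ofReal.2 h
    rw [← sub_eq_add_neg] at h'
    refine h'.congr_fun ?_
    intro m; rw [neg_pow]; push_cast; ring
  · rw [← NNReal.coe_le_coe]
    push_cast
    refine le_trans (le_of_eq (Finset.sum_congr rfl fun m _ => ?_)) (sum_abs_choose_le h0 h1 M)
    rw [← Complex.ofReal_one, ← Complex.ofReal_neg, ← Complex.ofReal_pow, ← Complex.ofReal_choose, ← Complex.ofReal_mul, Complex.norm_real]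
    simp

end IsLocalMultiplier

/-! ### Cutoffs, coordinates and Gaussians as multipliers -/

section Symbols

/-- The frequency cube `k + [-1, 1]ⁿ` in the normalisation `ξ = 2πη`. -/
def freqCell {n : ℕ} (k : Fin n → ℤ) : Set (Rn n) := {η | ∀ i, |2 * Real.pi * η i - k i| ≤ 1}

/-- The lattice point `k` in the normalisation `ξ = 2πη`. -/
noncomputable def freqCenter {n : ℕ} (k : Fin n → ℤ) : Rn n := (2 * Real.pi)⁻¹ • latticePt k

theorem two_pi_smul_sub_freqCenter {n : ℕ} (k : Fin n → ℤ) (η : Rn n) :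
    (2 * Real.pi) • (η - freqCenter k) = (2 * Real.pi) • η - latticePt k := by
  rw [freqCenter, smul_sub, smul_smul, mul_inv_cancel₀ (by positivity), one_smul]

theorem latticePt_apply {n : ℕ} (k : Fin n → ℤ) (i : Fin n) : latticePt k i = k i := rfl

theorem norm_le_nat_of_abs_le_one {n : ℕ} {x : Rn n} (hx : ∀ i, |x i| ≤ 1) : ‖x‖ ≤ n := by
  rw [EuclideanSpace.norm_eq]
  calc √(∑ i, ‖x i‖ ^ 2) ≤ √(∑ _i : Fin n, 1) := by
        refine Real.sqrt_le_sqrt (Finset.sum_le_sum fun i _ => ?_)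
        rw [Real.norm_eq_abs]
        exact pow_le_one₀ (abs_nonneg _) (hx i)
    _ = √n := by simp
    _ ≤ n := by
        rcases Nat.eq_zero_or_pos n with rfl | h
        · simp
        · rw [Real.sqrt_le_left (by positivity)]
          have : (1 : ℝ) ≤ n := by exact_mod_cast h
          nlinarith

/-- The inner ball contains the cube because `√n ≤ n + 1`. The outer radius `n + 2`, plus one for
the half-side of a cube, is the `n + 3` in `neighbours`. -/
noncomputable def unitCubeBump (n : ℕ) : ContDiffBump (0 : Rn n) where
  rIn := n + 1
  rOut := n + 2
  rIn_pos := by positivity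
  rIn_lt_rOut := by linarith

theorem unitCubeBump_eq_one {n : ℕ} {x : Rn n} (hx : ∀ i, |x i| ≤ 1) : unitCubeBump n x = 1 :=
  (unitCubeBump n).one_of_mem_closedBall (by
    rw [mem_closedBall_zero_iff]
    exact (norm_le_nat_of_abs_le_one hx).trans (by simp [unitCubeBump]))

theorem hasCompactSupport_comp_two_pi_smul {n : ℕ} {f : Rn n → ℂ} (hf : HasCompactSupport f) :
    HasCompactSupport fun η => f ((2 * Real.pi) • η) :=
  hf.comp_homeomorph (Homeomorph.smulOfNeZero (2 * Real.pi : ℝ) (by positivity))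

/-- A smooth cutoff, equal to one on the cube `[-1, 1]ⁿ` (in the normalisation `ξ = 2πη`),
multiplied by the smooth function `g`. -/
noncomputable def cutoff {n : ℕ} (g : Rn n → ℂ) (hg : ContDiff ℝ (⊤ : ℕ∞) g) : 𝓢(Rn n, ℂ) :=
  HasCompactSupport.toSchwartzMap
    (f := fun η : Rn n => g ((2 * Real.pi) • η) * ((unitCubeBump n ((2 * Real.pi) • η) : ℝ) : ℂ))
    ((hasCompactSupport_comp_two_pi_smul (f := fun x => ((unitCubeBump n x : ℝ) : ℂ))
      ((unitCubeBump n).hasCompactSupport.comp_left (g := ((↑) : ℝ → ℂ)) (by simp))).mul_left)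
    ((hg.comp (contDiff_const_smul _)).mul
      (Complex.ofRealCLM.contDiff.comp ((unitCubeBump n).contDiff.comp (contDiff_const_smul _))))

theorem cutoff_apply {n : ℕ} (g : Rn n → ℂ) (hg : ContDiff ℝ (⊤ : ℕ∞) g) (η : Rn n) :
    cutoff g hg η = g ((2 * Real.pi) • η) * ((unitCubeBump n ((2 * Real.pi) • η) : ℝ) : ℂ) := rfl

/-- `L¹` norm of the convolution kernel of a Schwartz symbol. -/
noncomputable def kernelNorm {n : ℕ} (σ : 𝓢(Rn n, ℂ)) : ℝ≥0 := (∫⁻ y, ‖(𝓕⁻ σ) y‖ₑ).toNNReal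

namespace IsLocalMultiplier

variable {n : ℕ} {p : ℝ≥0∞} {S : Set (Rn n)}

theorem of_schwartz (hp : 1 ≤ p) (σ : 𝓢(Rn n, ℂ)) : IsLocalMultiplier p S σ (kernelNorm σ) := by
  have h := of_fourier (S := S) hp (𝓕⁻ σ).continuous.measurable (𝓕⁻ σ).integrable
  rwa [← SchwartzMap.fourier_coe, FourierTransform.fourier_fourierInv_eq] at h

theorem of_schwartz_translate (hp : 1 ≤ p) (σ : 𝓢(Rn n, ℂ)) (c : Rn n) :
    IsLocalMultiplier p S (fun η => σ (η - c)) (kernelNorm σ) :=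
  ((of_schwartz (S := Set.univ) hp σ).translate c).mono_set fun _ _ => Set.mem_univ _

theorem contDiff_ofReal_coord (i : Fin n) :
    ContDiff ℝ (⊤ : ℕ∞) fun x : Rn n => ((x i : ℝ) : ℂ) :=
  Complex.ofRealCLM.contDiff.comp (by fun_prop : ContDiff ℝ (⊤ : ℕ∞) fun x : Rn n => x i)

/-- On the cube the unbounded coordinate agrees with a translate of one fixed Schwartz symbol, so
the constant does not depend on `k`. -/
theorem coord_sub (hp : 1 ≤ p) (k : Fin n → ℤ) (i : Fin n) :
    IsLocalMultiplier p (freqCell k) (fun η => ((2 * Real.pi * η i - k i : ℝ) : ℂ))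
      (kernelNorm (cutoff (fun x : Rn n => ((x i : ℝ) : ℂ)) (contDiff_ofReal_coord i))) := by
  refine (of_schwartz_translate hp _ (freqCenter k)).congr
    (by fun_prop : Continuous _).measurable fun η hη => ?_
  rw [cutoff_apply, two_pi_smul_sub_freqCenter, unitCubeBump_eq_one]
  · simp [latticePt_apply]
  · intro j
    simpa [latticePt_apply] using hη j

/-- The convolution kernel is a positive Gaussian of integral one, so the norm is at most 1 for
every `s`. An exact 1, with no dimensional constant, is needed to take powers in `one_sub_rpow`. -/
theorem gaussian (hp : 1 ≤ p) {s : ℝ} (hs : 0 < s) :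
    IsLocalMultiplier p S (fun η : Rn n => ((Real.exp (-s * ‖η‖ ^ 2) : ℝ) : ℂ)) 1 := by
  set b : ℝ := Real.pi ^ 2 / s with hb
  have hb0 : 0 < b := by positivity
  have hJint := GaussianFourier.integral_rexp_neg_mul_sq_norm (V := Rn n) hb0
  set J := ∫ v : Rn n, Real.exp (-b * ‖v‖ ^ 2) with hJ
  have hJ0 : 0 < J := by rw [hJint]; positivity
  -- A nonzero Bochner integral forces integrability.
  have hi : Integrable fun v : Rn n => Real.exp (-b * ‖v‖ ^ 2) := by
    by_contra hc
    exact hJ0.ne' (integral_undef hc)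
  set K : Rn n → ℂ := fun v => ((J⁻¹ * Real.exp (-b * ‖v‖ ^ 2) : ℝ) : ℂ) with hK
  have hKi : Integrable K := (hi.const_mul J⁻¹).ofReal
  have hF : 𝓕 K = fun η : Rn n => ((Real.exp (-s * ‖η‖ ^ 2) : ℝ) : ℂ) := by
    have h := fun w : Rn n => fourier_gaussian_innerProductSpace (b := (b : ℂ))
      (by simpa using hb0) w
    ext η
    have h1 : 𝓕 K η = (J : ℂ)⁻¹ * 𝓕 (fun v : Rn n => Complex.exp (-b * ‖v‖ ^ 2)) η := by
      simp only [Real.fourier_eq', smul_eq_mul, ← integral_const_mul]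
      congr 1; ext v
      simp only [hK]; push_cast; ring
    rw [h1, h, hJint]
    have h2 : ((Real.pi / b : ℂ)) ^ (Module.finrank ℝ (Rn n) / 2 : ℂ)
        = (((Real.pi / b) ^ (Module.finrank ℝ (Rn n) / 2 : ℝ) : ℝ) : ℂ) := by
      rw [Complex.ofReal_cpow (by positivity)]; push_cast; rfl
    rw [h2, ← mul_assoc, inv_mul_cancel₀, one_mul]
    · push_cast; congr 1; rw [hb]; push_cast; field_simp
    · rw [← hJint]; exact_mod_cast hJ0.ne'
  rw [← hF]
  refine (of_fourier hp (by fun_prop : Continuous K).measurable hKi).mono_bound ?_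
  rw [← NNReal.coe_le_coe]
  change (∫⁻ y, ‖K y‖ₑ).toReal ≤ 1
  rw [← integral_norm_eq_lintegral_enorm hKi.aestronglyMeasurable]
  have h3 : ∀ v, ‖K v‖ = J⁻¹ * Real.exp (-b * ‖v‖ ^ 2) := fun v => by
    rw [hK, Complex.norm_real, Real.norm_of_nonneg (by positivity)]
  simp only [h3]
  rw [integral_const_mul, ← hJ, inv_mul_cancel₀ hJ0.ne']

/-- Real valued symbols can be exponentiated. -/
theorem exp_I_mul (hp : 1 ≤ p) {h : Rn n → ℝ} {A : ℝ≥0}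
    (hh : IsLocalMultiplier p S (fun η => (h η : ℂ)) A) :
    IsLocalMultiplier p S (fun η => Complex.exp (Complex.I * (h η : ℂ))) (Real.exp A).toNNReal := by
  simpa using (hh.const_mul Complex.I).exp hp

end IsLocalMultiplier

end Symbols

/-! ### Uniform bounds for the unimodular symbols on frequency cubes -/

section Phase

variable {n : ℕ} {p : ℝ≥0∞} {S : Set (Rn n)}

/-- The regularised symbol `δ² + |ξ|²`, `ξ = 2πη`. -/
noncomputable def regSq {n : ℕ} (δ : ℝ) (η : Rn n) : ℝ := δ ^ 2 + ‖(2 * Real.pi) • η‖ ^ 2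

theorem regSq_pos {δ : ℝ} (hδ : 0 < δ) (η : Rn n) : 0 < regSq δ η := by
  unfold regSq; positivity

theorem continuous_regSq (δ : ℝ) : Continuous (regSq δ : Rn n → ℝ) := by
  unfold regSq; fun_prop

theorem norm_sq_latticePt (k : Fin n → ℤ) : ‖latticePt k‖ ^ 2 = ∑ i, (k i : ℝ) ^ 2 := by
  rw [EuclideanSpace.norm_sq_eq]
  simp [latticePt_apply]

theorem abs_le_norm_latticePt (k : Fin n → ℤ) (i : Fin n) : |(k i : ℝ)| ≤ ‖latticePt k‖ := by
  have := PiLp.norm_apply_le (latticePt k) i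
  simpa [latticePt_apply] using this

theorem regSq_eq (δ : ℝ) (k : Fin n → ℤ) (η : Rn n) :
    regSq δ η = δ ^ 2 + ‖latticePt k‖ ^ 2 + ∑ i, (2 * (k i : ℝ) * (2 * Real.pi * η i - k i)
      + (2 * Real.pi * η i - k i) ^ 2) := by
  rw [norm_sq_latticePt, add_assoc, ← Finset.sum_add_distrib, regSq, EuclideanSpace.norm_sq_eq]
  congr 1
  refine Finset.sum_congr rfl fun i _ => ?_
  simp only [PiLp.smul_apply, smul_eq_mul, Real.norm_eq_abs, sq_abs]
  ring

/-- The function `(1 - e^{-x})/x` minus its value at zero. -/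
theorem hasSum_one_sub_exp_neg_div {x : ℝ} (hx : 0 < x) :
    HasSum (fun m : ℕ => (-1) ^ (m + 1) / ((m + 2).factorial : ℝ) * x ^ (m + 1))
      ((1 - Real.exp (-x)) / x - 1) := by
  have h := NormedSpace.expSeries_div_hasSum_exp (-x)
  rw [← Real.exp_eq_exp_ℝ] at h
  have h2 := ((hasSum_nat_add_iff' 2).2 h).mul_left (-x⁻¹)
  simp only [Finset.sum_range_succ, Finset.sum_range_zero] at h2
  have h3 : (1 - Real.exp (-x)) / x - 1 = -x⁻¹ * (Real.exp (-x) -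
      (0 + (-x) ^ 0 / ((Nat.factorial 0 : ℕ) : ℝ) + (-x) ^ 1 / ((Nat.factorial 1 : ℕ) : ℝ))) := by
    simp only [Nat.factorial, pow_zero, pow_one]
    field_simp
    push_cast
    ring
  rw [h3]
  refine h2.congr_fun fun m => ?_
  rw [neg_pow x]
  field_simp
  ring

/-- With `x` a small multiple of the symbol, write `x^β = (1 - e^{-x})^β · ((1 - e^{-x})/x)^{-β}`.
The first factor is a binomial series at its boundary of convergence, which is harmless because the
Gaussian `e^{-x}` is a contraction. The second is a binomial series in `(1 - e^{-x})/x - 1`, which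
is small with `x`. No derivative of `x^β` near zero enters, so the bound is uniform in `δ`. -/
theorem exists_isLocalMultiplier_regSq_rpow_of_bound (hp : 1 ≤ p) {A : ℝ≥0} {β : ℝ} (hβ0 : 0 ≤ β)
    (hβ1 : β ≤ 1) {δ : ℝ} (hδ0 : 0 < δ) (hA1 : 1 ≤ A)
    (h : IsLocalMultiplier p S (fun η => (regSq δ η : ℂ)) A) :
    IsLocalMultiplier p S (fun η => ((regSq δ η ^ β : ℝ) : ℂ)) (8 * A) := by
  -- Chosen so that `x = t * regSq δ` has multiplier norm at most 1/2.
  set t : ℝ := (2 * (A : ℝ))⁻¹ with ht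
  have hA1' : (1 : ℝ) ≤ A := by exact_mod_cast hA1
  have ht0 : 0 < t := by positivity
  set x : Rn n → ℝ := fun η => t * regSq δ η with hx
  have hx0 : ∀ η, 0 < x η := fun η => mul_pos ht0 (regSq_pos hδ0 η)
  have hxc : Continuous x := (continuous_regSq δ).const_mul t
  have hxm : IsLocalMultiplier p S (fun η => (x η : ℂ)) (1 / 2) := by
    have h2 := (h.const_mul (t : ℂ)).mono_bound (B := 1 / 2) (by
      rw [← NNReal.coe_le_coe]; push_cast
      rw [Complex.norm_real, Real.norm_of_nonneg ht0.le, ht]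
      apply le_of_eq; field_simp)
    simpa [hx] using h2
  have hP : IsLocalMultiplier p S (fun η => ((Real.exp (-x η) : ℝ) : ℂ)) 1 := by
    have h3 := IsLocalMultiplier.gaussian (S := S) hp (s := t * (2 * Real.pi) ^ 2) (by positivity)
    have h4 := (h3.const_mul ((Real.exp (-(t * δ ^ 2)) : ℝ) : ℂ)).mono_bound (B := 1) (by
      rw [mul_one, ← NNReal.coe_le_coe, coe_nnnorm, Complex.norm_real,
        Real.norm_of_nonneg (Real.exp_pos _).le]
      exact Real.exp_le_one_iff.2 (by nlinarith [mul_pos ht0 (pow_pos hδ0 2)]))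
    refine h4.congr (by fun_prop : Continuous _).measurable fun η _ => ?_
    rw [← Complex.ofReal_mul, ← Real.exp_add]
    congr 2
    simp only [hx, regSq, norm_smul]
    rw [Real.norm_of_nonneg (by positivity)]; ring
  have h1P := hP.one_sub_rpow hp (fun η _ => by
    rw [abs_of_pos (Real.exp_pos _)]
    exact Real.exp_lt_one_iff.2 (neg_lt_zero.2 (hx0 η))) hβ0 hβ1
  have hz : IsLocalMultiplier p S (fun η => (((1 - Real.exp (-x η)) / x η - 1 : ℝ) : ℂ)) (1 / 2) := by
    refine IsLocalMultiplier.of_hasSum hp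
      (a := fun m η => (((-1) ^ (m + 1) / ((m + 2).factorial : ℝ) : ℝ) : ℂ) * (x η : ℂ) ^ (m + 1))
      (fun m => (hxm.pow (m + 1)).const_mul _) ?_ (fun η _ => ?_) (fun M => ?_)
    · exact Complex.measurable_ofReal.comp
        (((hxc.neg.rexp.measurable.const_sub 1).div hxc.measurable).sub_const 1)
    · exact_mod_cast Complex.hasSum_ofReal.2 (hasSum_one_sub_exp_neg_div (hx0 η))
    · have hb : ∀ m : ℕ, ‖(((-1) ^ (m + 1) / ((m + 2).factorial : ℝ) : ℝ) : ℂ)‖₊ * (1 / 2) ^ (m + 1)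
          ≤ (1 / 4 : ℝ≥0) * (‖(1 : ℂ)‖₊ * (1 / 2 : ℝ≥0) ^ m) := by
        intro m
        have h6 : ‖(((-1) ^ (m + 1) / ((m + 2).factorial : ℝ) : ℝ) : ℂ)‖₊ ≤ 1 / 2 := by
          rw [← NNReal.coe_le_coe, coe_nnnorm, Complex.norm_real]
          simp only [norm_div, norm_pow, norm_neg, norm_one, one_pow, RCLike.norm_natCast]
          push_cast
          refine one_div_le_one_div_of_le (by norm_num) ?_
          have := Nat.factorial_le (show 2 ≤ m + 2 by omega)
          exact_mod_cast this
        calc _ ≤ 1 / 2 * (1 / 2 : ℝ≥0) ^ (m + 1) := by gcongr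
          _ = _ := by
            rw [← NNReal.coe_inj]; push_cast; rw [pow_succ]; simp; ring
      refine (Finset.sum_le_sum fun m _ => hb m).trans ?_
      rw [← Finset.mul_sum]
      have h7 := IsLocalMultiplier.sum_geometric_le (A := 1 / 2) le_rfl (c := fun _ => (1 : ℂ))
        (by simp) M
      calc _ ≤ 1 / 4 * (2 : ℝ≥0) := by gcongr
        _ = 1 / 2 := by rw [← NNReal.coe_inj]; push_cast; norm_num
  have hE := hz.one_add_rpow hp le_rfl (β := -β) (by linarith) (by linarith)
  -- Each binomial factor costs 2, and undoing the scaling costs `t^{-β} ≤ 2A`; together `8A`.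
  have hfin := ((h1P.mul hE).const_mul ((t ^ (-β) : ℝ) : ℂ)).mono_bound (B := 8 * A) (by
    have h8 : t ^ (-β) ≤ 2 * A := by
      rw [Real.rpow_neg ht0.le, ← Real.inv_rpow ht0.le, ht, inv_inv]
      calc (2 * (A : ℝ)) ^ β ≤ (2 * (A : ℝ)) ^ (1 : ℝ) :=
            Real.rpow_le_rpow_of_exponent_le (by linarith) hβ1
        _ = _ := Real.rpow_one _
    rw [← NNReal.coe_le_coe]; push_cast
    rw [Complex.norm_real, Real.norm_of_nonneg (by positivity)]
    nlinarith)
  refine hfin.congr (Complex.measurable_ofReal.comp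
    ((continuous_regSq δ).measurable.pow_const β)) fun η _ => ?_
  rw [← Complex.ofReal_mul, ← Complex.ofReal_mul]
  congr 1
  have h9 : 0 < 1 - Real.exp (-x η) := by
    have := Real.exp_lt_one_iff.2 (neg_lt_zero.2 (hx0 η)); linarith
  rw [add_sub_cancel, Real.rpow_neg (div_nonneg h9.le (hx0 η).le), Real.div_rpow h9.le (hx0 η).le,
    Real.rpow_neg ht0.le]
  have h10 : x η ^ β = t ^ β * regSq δ η ^ β := Real.mul_rpow ht0.le (regSq_pos hδ0 η).le
  rw [h10]
  have h11 : 0 < (1 - Real.exp (-x η)) ^ β := Real.rpow_pos_of_pos h9 _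
  have h12 : 0 < t ^ β := Real.rpow_pos_of_pos ht0 _
  field_simp

/-- Bound for the coordinate symbols on a frequency cube. -/
noncomputable def coordBound (n : ℕ) : ℝ≥0 :=
  ∑ i, kernelNorm (cutoff (fun x : Rn n => ((x i : ℝ) : ℂ))
    (IsLocalMultiplier.contDiff_ofReal_coord i))

theorem isLocalMultiplier_coord_sub (hp : 1 ≤ p) (k : Fin n → ℤ) (i : Fin n) :
    IsLocalMultiplier p (freqCell k) (fun η => ((2 * Real.pi * η i - k i : ℝ) : ℂ))
      (coordBound n) :=
  (IsLocalMultiplier.coord_sub hp k i).mono_bound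
    (Finset.single_le_sum (f := fun i => kernelNorm (cutoff (fun x : Rn n => ((x i : ℝ) : ℂ))
      (IsLocalMultiplier.contDiff_ofReal_coord i))) (fun _ _ => zero_le) (Finset.mem_univ i))

/-- The increment of `|ξ|²` over a frequency cube. -/
theorem isLocalMultiplier_increment (hp : 1 ≤ p) (k : Fin n → ℤ) {R : ℝ≥0}
    (hR : ‖latticePt k‖ ≤ R) :
    IsLocalMultiplier p (freqCell k) (fun η => ((∑ i, (2 * (k i : ℝ) * (2 * Real.pi * η i - k i)
      + (2 * Real.pi * η i - k i) ^ 2) : ℝ) : ℂ)) (n * (2 * R * coordBound n + coordBound n ^ 2)) := by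
  have h : ∀ i ∈ Finset.univ, IsLocalMultiplier p (freqCell k)
      (fun η : Rn n => (((2 * (k i : ℝ) : ℝ) : ℂ) * ((2 * Real.pi * η i - k i : ℝ) : ℂ)
        + ((2 * Real.pi * η i - k i : ℝ) : ℂ) ^ 2)) (2 * R * coordBound n + coordBound n ^ 2) := by
    intro i _
    refine IsLocalMultiplier.add hp (((isLocalMultiplier_coord_sub hp k i).const_mul _).mono_bound ?_)
      ((isLocalMultiplier_coord_sub hp k i).pow 2)
    gcongr
    rw [← NNReal.coe_le_coe, coe_nnnorm, Complex.norm_real, Real.norm_eq_abs, abs_mul]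
    push_cast
    rw [abs_of_pos (zero_lt_two (α := ℝ))]
    have := (abs_le_norm_latticePt k i).trans hR
    linarith
  have h2 := IsLocalMultiplier.sum hp h
  rw [Finset.sum_const, Finset.card_univ, Fintype.card_fin, nsmul_eq_mul] at h2
  refine h2.congr (by fun_prop : Continuous _).measurable fun η _ => ?_
  push_cast; rfl

/-- Bounds for small frequencies. -/
theorem isLocalMultiplier_regSq (hp : 1 ≤ p) (k : Fin n → ℤ) {R : ℝ≥0}
    (hR : ‖latticePt k‖ ≤ R) {δ : ℝ} (hδ0 : 0 < δ) (hδ1 : δ ≤ 1) :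
    IsLocalMultiplier p (freqCell k) (fun η => (regSq δ η : ℂ))
      (1 + R ^ 2 + n * (2 * R * coordBound n + coordBound n ^ 2)) := by
  have h := (IsLocalMultiplier.const (p := p) (S := freqCell k)
    ((δ ^ 2 + ‖latticePt k‖ ^ 2 : ℝ) : ℂ)).mono_bound (B := 1 + R ^ 2) (by
      rw [← NNReal.coe_le_coe, coe_nnnorm, Complex.norm_real, Real.norm_of_nonneg (by positivity)]
      push_cast
      gcongr
      exact pow_le_one₀ hδ0.le hδ1)
  refine (h.add hp (isLocalMultiplier_increment hp k hR)).congr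
    (Complex.measurable_ofReal.comp (continuous_regSq δ).measurable) fun η _ => ?_
  rw [regSq_eq δ k, Complex.ofReal_add]

/-- Multiplier bound at high frequency. -/
theorem isLocalMultiplier_exp_regSq_of_large (hp : 1 ≤ p) (k : Fin n → ℤ)
    {D : ℝ≥0} (hD : D = n * (2 * coordBound n + coordBound n ^ 2))
    (hk1 : 1 ≤ ‖latticePt k‖) (hkD : 2 * D ≤ ‖latticePt k‖)
    {β : ℝ} (hβ0 : 0 ≤ β) (hβ1 : β ≤ 1) {δ : ℝ} (hδ0 : 0 < δ) (hδ1 : δ ≤ 1) {ε : ℝ}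
    (hε : |ε| ≤ 1) :
    IsLocalMultiplier p (freqCell k)
      (fun η => Complex.exp (Complex.I * ((ε * regSq δ η ^ β : ℝ) : ℂ)))
      (Real.exp ((n * coordBound n ^ 2 + 4 * D ^ 2 : ℝ≥0) : ℝ)).toNNReal := by
  set r : ℝ≥0 := ‖latticePt k‖₊ with hr
  have hrr : (r : ℝ) = ‖latticePt k‖ := rfl
  have hr1 : 1 ≤ r := by rw [← NNReal.coe_le_coe, hrr]; exact_mod_cast hk1
  have hr1' : (1 : ℝ) ≤ r := hk1
  set L : ℝ := δ ^ 2 + ‖latticePt k‖ ^ 2 with hL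
  have hL0 : (r : ℝ) ^ 2 ≤ L := by rw [hL, hrr]; nlinarith [sq_nonneg δ]
  have hL1 : 1 ≤ L := by nlinarith
  have hL2 : L ≤ 2 * (r : ℝ) ^ 2 := by rw [hL]; rw [← hrr]; nlinarith
  have hLpos : 0 < L := by linarith
  set X : Fin n → Rn n → ℝ := fun i η => 2 * Real.pi * η i - k i with hX
  -- The relative increment, `regSq δ η = L * (1 + z η)`. The increment is of order `r` on the cube
  -- and `L ≥ r²`, so `z` has norm at most `D / r`.
  set z : Rn n → ℝ := fun η => L⁻¹ * ∑ i, (2 * (k i : ℝ) * X i η + X i η ^ 2) with hz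
  have hzm : IsLocalMultiplier p (freqCell k) (fun η => (z η : ℂ)) (D / r) := by
    have h := ((isLocalMultiplier_increment hp k (R := r) le_rfl).const_mul
      ((L⁻¹ : ℝ) : ℂ)).mono_bound (B := D / r) (by
        rw [← NNReal.coe_le_coe, NNReal.coe_mul, coe_nnnorm, Complex.norm_real,
          Real.norm_of_nonneg (by positivity), hD]
        push_cast
        rw [inv_mul_le_iff₀ hLpos]
        have hr0 : (0 : ℝ) < r := by linarith
        obtain ⟨c, hc⟩ : ∃ c : ℝ, c = coordBound n := ⟨_, rfl⟩
        obtain ⟨ρ, hρ⟩ : ∃ ρ : ℝ, ρ = r := ⟨_, rfl⟩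
        rw [← hρ] at hr0 hr1' hL0 ⊢
        rw [← hc]
        calc (n : ℝ) * (2 * ρ * c + c ^ 2)
            ≤ n * (2 * ρ * c + ρ * c ^ 2) := by gcongr; nlinarith [sq_nonneg c]
          _ = ρ ^ 2 * (n * (2 * c + c ^ 2) / ρ) := by field_simp
          _ ≤ _ := by
            have : (0 : ℝ) ≤ c := hc ▸ NNReal.coe_nonneg _
            gcongr)
    simpa [hz, hX] using h
  have hA : D / r ≤ 1 / 2 := by
    rw [div_le_div_iff₀ (by positivity) (by norm_num), ← NNReal.coe_le_coe]
    push_cast; linarith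
  have hrem := hzm.one_add_rpow_sub hp hA (by linarith : -1 ≤ β) hβ1
  have hLβ : L ^ β ≤ 2 * (r : ℝ) ^ 2 :=
    ((Real.rpow_le_rpow_of_exponent_le hL1 hβ1).trans_eq (Real.rpow_one L)).trans hL2
  have hLβ0 : 0 < L ^ β := Real.rpow_pos_of_pos hLpos _
  -- Here `β ≤ 1` is decisive: `L^β ≤ 2r²` absorbs the factor `(D/r)²` of the second order
  -- remainder, leaving a bound free of `k`.
  have hrem2 := (hrem.const_mul ((ε * L ^ β : ℝ) : ℂ)).mono_bound (B := 4 * D ^ 2) (by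
    rw [← NNReal.coe_le_coe]
    push_cast
    rw [← Complex.ofReal_mul, Complex.norm_real, norm_mul, Real.norm_of_nonneg hLβ0.le, Real.norm_eq_abs]
    calc |ε| * L ^ β * (((D : ℝ) / r) ^ 2 * 2) ≤ 1 * (2 * (r : ℝ) ^ 2) * (((D : ℝ) / r) ^ 2 * 2) := by
          gcongr
      _ = 4 * (D : ℝ) ^ 2 := by field_simp; ring)
  -- The derivative of `x ↦ x^β` at `L`, at most one because `L ≥ 1` and `β ≤ 1`. It is the
  -- coefficient of the quadratic part of the increment.
  set θ : ℝ := β * (L ^ β * L⁻¹) with hθ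
  have hθ1 : θ ≤ 1 := by
    have h1 : L ^ β ≤ L := (Real.rpow_le_rpow_of_exponent_le hL1 hβ1).trans_eq (Real.rpow_one L)
    have h2 : L ^ β * L⁻¹ ≤ 1 := by rw [← div_eq_mul_inv, div_le_one hLpos]; exact h1
    calc θ ≤ 1 * 1 := by rw [hθ]; gcongr
      _ = 1 := one_mul 1
  have hθ0 : 0 ≤ θ := by positivity
  have hquad := ((IsLocalMultiplier.sum hp (s := Finset.univ) fun i _ =>
    (isLocalMultiplier_coord_sub hp k i).pow 2).const_mul ((ε * θ : ℝ) : ℂ)).mono_bound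
      (B := n * coordBound n ^ 2) (by
    rw [Finset.sum_const, Finset.card_univ, Fintype.card_fin, nsmul_eq_mul]
    have : ‖((ε * θ : ℝ) : ℂ)‖₊ ≤ 1 := by
      rw [← NNReal.coe_le_coe, coe_nnnorm, Complex.norm_real, norm_mul, Real.norm_of_nonneg hθ0, Real.norm_eq_abs]
      exact mul_le_one₀ hε hθ0 hθ1
    calc _ ≤ 1 * ((n : ℝ≥0) * coordBound n ^ 2) := by gcongr
      _ = _ := one_mul _)
  have hnl : IsLocalMultiplier p (freqCell k) (fun η => ((ε * θ * ∑ i, X i η ^ 2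
      + ε * L ^ β * ((1 + z η) ^ β - 1 - β * z η) : ℝ) : ℂ))
      (n * coordBound n ^ 2 + 4 * D ^ 2) := by
    have h := hquad.add hp hrem2
    refine h.congr ?_ fun η _ => ?_
    · have := h.measurable
      convert this using 2 with η
      simp only [hX]; push_cast; ring
    · simp only [hX]; push_cast; ring
  -- The affine part of the phase, whose slope may grow with `k`; it is only a translation in space
  -- and has norm one.
  have hlin := IsLocalMultiplier.exp_inner p (freqCell k)
    (ε * L ^ β - ε * θ * (2 * ‖latticePt k‖ ^ 2)) ((ε * θ * (4 * Real.pi)) • latticePt k)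
  have hfin := (hlin.mul (hnl.exp_I_mul hp))
  rw [one_mul] at hfin
  refine hfin.congr ?_ fun η hη => ?_
  · have h1 : Measurable fun η : Rn n => ε * regSq δ η ^ β :=
      ((continuous_regSq δ).measurable.pow_const β).const_mul ε
    exact Complex.measurable_exp.comp ((Complex.measurable_ofReal.comp h1).const_mul _)
  · rw [← Complex.exp_add, ← mul_add, ← Complex.ofReal_add]
    congr 3
    have hin : inner ℝ η (latticePt k) = ∑ i, η i * k i := by
      simp [PiLp.inner_apply, latticePt_apply, mul_comm]
    have hz1 : |z η| < 1 := (hzm.abs_le hη).trans_lt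
      (lt_of_le_of_lt (NNReal.coe_le_coe.2 hA) (by norm_num))
    have hreg : regSq δ η = L * (1 + z η) := by
      rw [regSq_eq δ k, mul_add, mul_one, hz, ← mul_assoc, mul_inv_cancel₀ hLpos.ne', one_mul]
    have hsplit : ∑ i, (2 * (k i : ℝ) * X i η + X i η ^ 2)
        = 4 * Real.pi * ∑ i, η i * k i - 2 * ‖latticePt k‖ ^ 2 + ∑ i, X i η ^ 2 := by
      rw [norm_sq_latticePt, Finset.sum_add_distrib, Finset.mul_sum, Finset.mul_sum,
        ← Finset.sum_sub_distrib]
      congr 1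
      refine Finset.sum_congr rfl fun i _ => ?_
      simp only [hX]; ring
    rw [hreg, Real.mul_rpow hLpos.le (by linarith [(abs_lt.1 hz1).1]), inner_smul_right, hin]
    have hz2 : z η = L⁻¹ * (4 * Real.pi * ∑ i, η i * k i - 2 * ‖latticePt k‖ ^ 2
        + ∑ i, X i η ^ 2) := by rw [← hsplit]
    have hz3 : ε * L ^ β * (β * z η) = ε * θ * (4 * Real.pi * ∑ i, η i * k i
        - 2 * ‖latticePt k‖ ^ 2 + ∑ i, X i η ^ 2) := by rw [hz2, hθ]; ring
    linear_combination hz3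

/-- Uniform multiplier bound for the regularised unimodular symbols on all frequency cubes. -/
theorem exists_isLocalMultiplier_exp_regSq (n : ℕ) {β : ℝ} (hβ0 : 0 ≤ β) (hβ1 : β ≤ 1) :
    ∃ C : ℝ≥0, ∀ (p : ℝ≥0∞), 1 ≤ p → ∀ (k : Fin n → ℤ) (δ : ℝ), 0 < δ → δ ≤ 1 → ∀ ε : ℝ, |ε| ≤ 1 →
      IsLocalMultiplier p (freqCell k)
        (fun η => Complex.exp (Complex.I * ((ε * regSq δ η ^ β : ℝ) : ℂ))) C := by
  set D : ℝ≥0 := n * (2 * coordBound n + coordBound n ^ 2) with hD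
  -- Beyond this threshold both `1 ≤ ‖latticePt k‖` and `2 * D ≤ ‖latticePt k‖` hold; below it every
  -- constant depends only on `R`.
  set R : ℝ≥0 := 1 + 2 * D with hR
  set A : ℝ≥0 := 1 + R ^ 2 + n * (2 * R * coordBound n + coordBound n ^ 2) with hA
  refine ⟨max (Real.exp ((n * coordBound n ^ 2 + 4 * D ^ 2 : ℝ≥0) : ℝ)).toNNReal
    (Real.exp ((8 * A : ℝ≥0) : ℝ)).toNNReal, fun p hp k δ hδ0 hδ1 ε hε => ?_⟩
  rcases le_total ‖latticePt k‖ R with hk | hk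
  · have h := exists_isLocalMultiplier_regSq_rpow_of_bound hp hβ0 hβ1 hδ0
      (by rw [add_assoc]; exact le_self_add) (isLocalMultiplier_regSq hp k hk hδ0 hδ1)
    have h2 := (h.const_mul (ε : ℂ)).mono_bound (B := 8 * A) (by
      have : ‖(ε : ℂ)‖₊ ≤ 1 := by
        rw [← NNReal.coe_le_coe, coe_nnnorm, Complex.norm_real]; exact hε
      calc _ ≤ 1 * (8 * A) := by gcongr
        _ = _ := one_mul _)
    have h3 : IsLocalMultiplier p (freqCell k) (fun η => ((ε * regSq δ η ^ β : ℝ) : ℂ)) (8 * A) := by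
      simpa using h2
    exact (h3.exp_I_mul hp).mono_bound (le_max_right _ _)
  · have hD0 : (0 : ℝ) ≤ D := D.2
    have hk' : 1 + 2 * (D : ℝ) ≤ ‖latticePt k‖ := by simpa [hR] using hk
    exact (isLocalMultiplier_exp_regSq_of_large hp k hD (by linarith) (by linarith) hβ0 hβ1 hδ0 hδ1
      hε).mono_bound (le_max_left _ _)

end Phase

/-! ### Extended `ℓ^q` norms -/

section SeqNorm

/-- The `ℓ^q` norm of a family of extended nonnegative numbers. -/
noncomputable def seqNorm {ι : Type*} (q : ℝ≥0∞) (a : ι → ℝ≥0∞) : ℝ≥0∞ :=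
  if q = ∞ then ⨆ k, a k else (∑' k, a k ^ q.toReal) ^ (1 / q.toReal)

theorem modNorm_eq_seqNorm {n : ℕ} (φ : 𝓢(Rn n, ℂ)) (p q : ℝ≥0∞) [Fact (1 ≤ p)] (s : ℝ)
    (f : 𝓢'(Rn n, ℂ)) : modNorm φ p q s f = seqNorm q (blockNorm φ p s f) := rfl

variable {ι : Type*} {q : ℝ≥0∞}

theorem toReal_pos_of_one_le (hq : 1 ≤ q) (hq' : q ≠ ∞) : 0 < q.toReal :=
  ENNReal.toReal_pos (zero_lt_one.trans_le hq).ne' hq'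

theorem seqNorm_mono {a b : ι → ℝ≥0∞} (h : ∀ k, a k ≤ b k) :
    seqNorm q a ≤ seqNorm q b := by
  unfold seqNorm
  split_ifs
  · exact iSup_mono h
  · exact ENNReal.rpow_le_rpow (ENNReal.tsum_le_tsum fun k =>
      ENNReal.rpow_le_rpow (h k) ENNReal.toReal_nonneg) (by positivity)

theorem seqNorm_const_mul (hq : 1 ≤ q) (C : ℝ≥0∞) (a : ι → ℝ≥0∞) :
    seqNorm q (fun k => C * a k) = C * seqNorm q a := by
  unfold seqNorm
  split_ifs with h
  · rw [ENNReal.mul_iSup]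
  · have hr := toReal_pos_of_one_le hq h
    simp only [ENNReal.mul_rpow_of_nonneg _ _ hr.le, ENNReal.tsum_mul_left]
    rw [ENNReal.mul_rpow_of_nonneg _ _ (by positivity), ← ENNReal.rpow_mul, mul_one_div,
      div_self hr.ne', ENNReal.rpow_one]

theorem le_seqNorm (hq : 1 ≤ q) (a : ι → ℝ≥0∞) (k : ι) : a k ≤ seqNorm q a := by
  unfold seqNorm
  split_ifs with h
  · exact le_iSup a k
  · have hr := toReal_pos_of_one_le hq h
    calc a k = (a k ^ q.toReal) ^ (1 / q.toReal) := by
          rw [← ENNReal.rpow_mul, mul_one_div, div_self hr.ne', ENNReal.rpow_one]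
      _ ≤ _ := ENNReal.rpow_le_rpow (ENNReal.le_tsum k) (by positivity)

/-- Summing over finitely many neighbours is bounded on `ℓ^q`. -/
theorem seqNorm_sum_neighbours_le {G : Type*} [AddCommGroup G] (hq : 1 ≤ q) (J : Finset G)
    (a : G → ℝ≥0∞) : seqNorm q (fun l => ∑ j ∈ J, a (l + j)) ≤ J.card * seqNorm q a := by
  by_cases h : q = ∞
  · simp only [seqNorm, h, if_true]
    refine iSup_le fun l => ?_
    calc ∑ j ∈ J, a (l + j) ≤ ∑ _j ∈ J, ⨆ k, a k := Finset.sum_le_sum fun j _ => le_iSup a (l + j)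
      _ = _ := by simp
  · simp only [seqNorm, h, if_false]
    have hr := toReal_pos_of_one_le hq h
    have hr1 : 1 ≤ q.toReal := by
      rw [← ENNReal.toReal_one]; exact ENNReal.toReal_mono h hq
    rcases J.eq_empty_or_nonempty with rfl | hJ
    · simp [hr]
    have hc0 : (J.card : ℝ≥0∞) ≠ 0 := by simpa using hJ.ne_empty
    have hct : (J.card : ℝ≥0∞) ≠ ∞ := ENNReal.natCast_ne_top _
    have h1 : ∑' l, (∑ j ∈ J, a (l + j)) ^ q.toReal
        ≤ (J.card : ℝ≥0∞) ^ q.toReal * ∑' l, a l ^ q.toReal := by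
      calc ∑' l, (∑ j ∈ J, a (l + j)) ^ q.toReal
          ≤ ∑' l, (J.card : ℝ≥0∞) ^ (q.toReal - 1) * ∑ j ∈ J, a (l + j) ^ q.toReal :=
            ENNReal.tsum_le_tsum fun l =>
              ENNReal.rpow_sum_le_const_mul_sum_rpow J (fun j => a (l + j)) hr1
        _ = (J.card : ℝ≥0∞) ^ (q.toReal - 1) * ∑ j ∈ J, ∑' l, a (l + j) ^ q.toReal := by
            rw [ENNReal.tsum_mul_left, Summable.tsum_finsetSum fun _ _ => ENNReal.summable]
        _ = (J.card : ℝ≥0∞) ^ (q.toReal - 1) * ∑ j ∈ J, ∑' l, a l ^ q.toReal := by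
            congr 1
            exact Finset.sum_congr rfl fun j _ =>
              (Equiv.addRight j).tsum_eq (fun l => a l ^ q.toReal)
        _ = _ := by
            rw [Finset.sum_const, nsmul_eq_mul, ← mul_assoc]
            congr 1
            nth_rewrite 2 [← ENNReal.rpow_one (J.card : ℝ≥0∞)]
            rw [← ENNReal.rpow_add _ _ hc0 hct]; simp
    refine (ENNReal.rpow_le_rpow h1 (by positivity)).trans (le_of_eq ?_)
    rw [ENNReal.mul_rpow_of_nonneg _ _ (by positivity), ← ENNReal.rpow_mul, mul_one_div,
      div_self hr.ne', ENNReal.rpow_one]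

end SeqNorm

/-! ### From the multiplier inequality to the Schwartz embedding inequality and back -/

section SchwartzMultipliers

variable {n : ℕ} {p : ℝ≥0∞}

theorem coe_fourierMultiplierCLM {a : Rn n → ℂ} (ha : a.HasTemperateGrowth) (v : 𝓢(Rn n, ℂ)) :
    ((SchwartzMap.fourierMultiplierCLM ℂ a v : 𝓢(Rn n, ℂ)) : Rn n → ℂ)
      = 𝓕⁻ (fun η => a η * 𝓕 (v : Rn n → ℂ) η) := by
  rw [SchwartzMap.fourierMultiplierCLM_apply, SchwartzMap.fourierInv_coe]
  congr 1
  ext η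
  rw [SchwartzMap.smulLeftCLM_apply_apply ha, SchwartzMap.fourier_coe, smul_eq_mul]

theorem fourier_fourierMultiplierCLM {a : Rn n → ℂ} (ha : a.HasTemperateGrowth) (v : 𝓢(Rn n, ℂ))
    (η : Rn n) : 𝓕 (SchwartzMap.fourierMultiplierCLM ℂ a v) η = a η * 𝓕 v η := by
  rw [SchwartzMap.fourierMultiplierCLM_apply, FourierTransform.fourier_fourierInv_eq,
    SchwartzMap.smulLeftCLM_apply_apply ha, smul_eq_mul]

theorem IsLocalMultiplier.eLpNorm_fourierMultiplierCLM_le {S : Set (Rn n)} {a : Rn n → ℂ} {B : ℝ≥0}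
    (h : IsLocalMultiplier p S a B) (ha : a.HasTemperateGrowth) (v : 𝓢(Rn n, ℂ))
    (hv : ∀ η, η ∉ S → 𝓕 v η = 0) :
    eLpNorm (SchwartzMap.fourierMultiplierCLM ℂ a v) p volume ≤ B * eLpNorm v p volume := by
  rw [coe_fourierMultiplierCLM ha, ← SchwartzMap.fourier_coe]
  refine (h.eLpNorm_le _ (𝓕 v).integrable hv).trans (le_of_eq ?_)
  rw [← SchwartzMap.fourierInv_coe, FourierTransform.fourierInv_fourier_eq]

theorem hasTemperateGrowth_exp_I_mul :
    Function.HasTemperateGrowth fun t : ℝ => Complex.exp (Complex.I * (t : ℂ)) := by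
  have hd : ∀ m : ℕ, iteratedDeriv m (fun t : ℝ => Complex.exp (Complex.I * (t : ℂ)))
      = fun t : ℝ => Complex.I ^ m * Complex.exp (Complex.I * (t : ℂ)) := by
    intro m
    induction m with
    | zero => simp
    | succ m ih =>
      rw [iteratedDeriv_succ, ih]
      ext t
      have h1 : HasDerivAt (fun t : ℝ => Complex.exp (Complex.I * (t : ℂ)))
          (Complex.exp (Complex.I * (t : ℂ)) * (Complex.I * 1)) t :=
        ((Complex.ofRealCLM.hasDerivAt (x := t)).const_mul Complex.I).cexp
      rw [(h1.const_mul (Complex.I ^ m)).deriv]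
      ring
  refine ⟨?_, fun m => ⟨0, 1, fun t => ?_⟩⟩
  · exact Complex.contDiff_exp.comp (contDiff_const.mul Complex.ofRealCLM.contDiff)
  · rw [norm_iteratedFDeriv_eq_norm_iteratedDeriv, hd, norm_mul, mul_comm Complex.I,
      Complex.norm_exp_ofReal_mul_I]
    simp

/-- The regularised unimodular symbol `exp(iε(δ² + |ξ|²)^β)`. -/
noncomputable def regPhase {n : ℕ} (ε δ β : ℝ) (η : Rn n) : ℂ :=
  Complex.exp (Complex.I * ((ε * regSq δ η ^ β : ℝ) : ℂ))

/-- For `δ > 0` the phase is `ε δ^{2β} (1 + |2πη/δ|²)^β`, smooth at the origin. Hence the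
regularised operators map `𝓢` to itself and the hypotheses on Schwartz functions apply to their
outputs. -/
theorem hasTemperateGrowth_regPhase (ε : ℝ) {δ : ℝ} (hδ : 0 < δ) (β : ℝ) :
    (regPhase ε δ β : Rn n → ℂ).HasTemperateGrowth := by
  have h1 : Function.HasTemperateGrowth fun η : Rn n => ((2 * Real.pi / δ) • η) := by fun_prop
  have h2 := (Function.hasTemperateGrowth_one_add_norm_sq_rpow (Rn n) β).comp h1
  have h3 : Function.HasTemperateGrowth fun η : Rn n => ε * regSq δ η ^ β := by
    have h4 := (Function.HasTemperateGrowth.const (E := Rn n) (ε * (δ ^ 2) ^ β)).mul h2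
    have h5 : (fun η : Rn n => ε * regSq δ η ^ β) = (fun _ : Rn n => ε * (δ ^ 2) ^ β) *
        ((fun x : Rn n => (1 + ‖x‖ ^ 2) ^ β) ∘ fun η : Rn n => (2 * Real.pi / δ) • η) := by
      ext η
      simp only [Pi.mul_apply, Function.comp, mul_assoc]
      rw [← Real.mul_rpow (by positivity) (by positivity)]
      congr 2
      simp only [regSq, norm_smul, norm_div]
      rw [Real.norm_of_nonneg hδ.le]
      field_simp
    rw [h5]
    exact h4
  exact hasTemperateGrowth_exp_I_mul.comp h3

theorem norm_regPhase (ε δ β : ℝ) (η : Rn n) : ‖regPhase ε δ β η‖ = 1 := by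
  rw [regPhase, mul_comm, Complex.norm_exp_ofReal_mul_I]

theorem hasTemperateGrowth_window (φ : 𝓢(Rn n, ℂ)) (k : Fin n → ℤ) :
    Function.HasTemperateGrowth fun η : Rn n => φ ((2 * Real.pi) • η - latticePt k) := by
  have h1 : Function.HasTemperateGrowth fun η : Rn n => (2 * Real.pi) • η - latticePt k := by
    fun_prop
  exact φ.hasTemperateGrowth.comp h1

theorem IsWindow.eq_zero_of_notMem {φ : 𝓢(Rn n, ℂ)} (hφ : IsWindow φ) {k : Fin n → ℤ} {η : Rn n}
    (hη : η ∉ freqCell k) : φ ((2 * Real.pi) • η - latticePt k) = 0 := by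
  by_contra h
  refine hη fun i => ?_
  have := hφ.tsupport_subset (subset_tsupport _ h) i
  simpa [latticePt_apply] using this

/-- The frequency block of a Schwartz function, as a Schwartz function. -/
noncomputable def schwartzBlock (φ : 𝓢(Rn n, ℂ)) (k : Fin n → ℤ) : 𝓢(Rn n, ℂ) →L[ℂ] 𝓢(Rn n, ℂ) :=
  SchwartzMap.fourierMultiplierCLM ℂ (fun η : Rn n => φ ((2 * Real.pi) • η - latticePt k))

theorem freqBlock_coe (φ : 𝓢(Rn n, ℂ)) (k : Fin n → ℤ) (g : 𝓢(Rn n, ℂ)) :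
    freqBlock φ k (g : 𝓢'(Rn n, ℂ)) = (schwartzBlock φ k g : 𝓢'(Rn n, ℂ)) :=
  TemperedDistribution.fourierMultiplierCLM_toTemperedDistributionCLM_eq
    (hasTemperateGrowth_window φ k) g

theorem toTemperedDistribution_injective [Fact (1 ≤ p)] {g h : Lp ℂ p (volume : Measure (Rn n))}
    (hgh : (g : 𝓢'(Rn n, ℂ)) = h) : g = h := by
  have := Lp.ker_toTemperedDistributionCLM_eq_bot (F := ℂ) (μ := (volume : Measure (Rn n))) (p := p)
  exact LinearMap.ker_eq_bot.1 this hgh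

theorem distLpNorm_coe [Fact (1 ≤ p)] (g : Lp ℂ p (volume : Measure (Rn n))) :
    distLpNorm p (g : 𝓢'(Rn n, ℂ)) = ‖g‖ₑ := by
  refine le_antisymm (iInf_le_of_le g (iInf_le _ rfl)) (le_iInf₂ fun h hh => ?_)
  rw [toTemperedDistribution_injective hh]

theorem distLpNorm_schwartz [Fact (1 ≤ p)] (g : 𝓢(Rn n, ℂ)) :
    distLpNorm p (g : 𝓢'(Rn n, ℂ)) = eLpNorm g p volume := by
  rw [← Lp.toTemperedDistribution_toLp_eq (p := p) g, distLpNorm_coe, Lp.enorm_def]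
  exact eLpNorm_congr_ae (SchwartzMap.coeFn_toLp g p volume)

/-- The weight `⟨k⟩^s`. -/
noncomputable def weight {n : ℕ} (s : ℝ) (k : Fin n → ℤ) : ℝ≥0∞ :=
  ENNReal.ofReal ((1 + ‖latticePt k‖ ^ 2) ^ (s / 2))

theorem blockNorm_schwartz (φ : 𝓢(Rn n, ℂ)) [Fact (1 ≤ p)] (s : ℝ) (g : 𝓢(Rn n, ℂ))
    (k : Fin n → ℤ) :
    blockNorm φ p s g k = weight s k * eLpNorm (schwartzBlock φ k g) p volume := by
  rw [blockNorm, freqBlock_coe, distLpNorm_schwartz]; rfl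

/-- Multipliers commute with the blocks, and each block has spectrum in its own cube, where the
local bound applies. -/
theorem modNorm_regPhase_le [hp : Fact (1 ≤ p)] {q : ℝ≥0∞} (hq : 1 ≤ q) (s : ℝ)
    {φ : 𝓢(Rn n, ℂ)} (hφ : IsWindow φ) {ε δ β : ℝ} (hδ : 0 < δ) {C : ℝ≥0}
    (hC : ∀ k : Fin n → ℤ, IsLocalMultiplier p (freqCell k) (regPhase ε δ β) C) (g : 𝓢(Rn n, ℂ)) :
    modNorm φ p q s (SchwartzMap.fourierMultiplierCLM ℂ (regPhase ε δ β) g : 𝓢(Rn n, ℂ))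
      ≤ C * modNorm φ p q s g := by
  rw [modNorm_eq_seqNorm, modNorm_eq_seqNorm, ← seqNorm_const_mul hq]
  refine seqNorm_mono fun k => ?_
  rw [blockNorm_schwartz, blockNorm_schwartz, ← mul_assoc, mul_comm (C : ℝ≥0∞), mul_assoc]
  gcongr
  have hreg := hasTemperateGrowth_regPhase (n := n) ε hδ β
  have hw := hasTemperateGrowth_window φ k
  have hcomm : schwartzBlock φ k (SchwartzMap.fourierMultiplierCLM ℂ (regPhase ε δ β) g)
      = SchwartzMap.fourierMultiplierCLM ℂ (regPhase ε δ β) (schwartzBlock φ k g) := by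
    rw [schwartzBlock, SchwartzMap.fourierMultiplierCLM_fourierMultiplierCLM_apply hw hreg,
      SchwartzMap.fourierMultiplierCLM_fourierMultiplierCLM_apply hreg hw, mul_comm]
  rw [hcomm]
  refine (hC k).eLpNorm_fourierMultiplierCLM_le hreg _ fun η hη => ?_
  rw [schwartzBlock, fourier_fourierMultiplierCLM hw, hφ.eq_zero_of_notMem hη, zero_mul]

/-- The embedding inequality on the Schwartz space. -/
def SchwartzEmbedsLp (φ : 𝓢(Rn n, ℂ)) (p q : ℝ≥0∞) [Fact (1 ≤ p)] (s : ℝ) : Prop :=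
  ∃ C : ℝ≥0, ∀ g : 𝓢(Rn n, ℂ), eLpNorm g p volume ≤ C * modNorm φ p q s g

theorem tendsto_regPhase {α : ℝ} (hα : 0 ≤ α) (ε : ℝ) (η : Rn n) :
    Tendsto (fun δ : ℝ => regPhase ε δ (α / 2) η) (𝓝[>] 0)
      (𝓝 (Complex.exp (Complex.I * ((ε * ‖(2 * Real.pi) • η‖ ^ α : ℝ) : ℂ)))) := by
  have h1 : Tendsto (fun δ : ℝ => regSq δ η ^ (α / 2)) (𝓝[>] 0) (𝓝 (‖(2 * Real.pi) • η‖ ^ α)) := by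
    rcases hα.eq_or_lt with rfl | hα0
    · simp
    have h2 : Tendsto (fun δ : ℝ => regSq δ η) (𝓝[>] 0) (𝓝 (‖(2 * Real.pi) • η‖ ^ 2)) := by
      have : Continuous fun δ : ℝ => regSq δ η := by unfold regSq; fun_prop
      simpa [regSq] using (this.tendsto 0).mono_left nhdsWithin_le_nhds
    have h3 := h2.rpow_const (p := α / 2) (Or.inr (by positivity))
    rwa [← Real.rpow_natCast, ← Real.rpow_mul (norm_nonneg _),
      show ((2 : ℕ) : ℝ) * (α / 2) = α by push_cast; ring] at h3
  have h4 : Continuous fun t : ℝ => Complex.exp (Complex.I * ((ε * t : ℝ) : ℂ)) := by fun_prop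
  exact (h4.tendsto _).comp h1

theorem measurable_expSymbol (α ε : ℝ) : Measurable fun η : Rn n =>
    Complex.exp (Complex.I * ((ε * ‖(2 * Real.pi) • η‖ ^ α : ℝ) : ℂ)) := by
  have h1 : Measurable fun η : Rn n => ε * ‖(2 * Real.pi) • η‖ ^ α := by fun_prop
  exact Complex.measurable_exp.comp ((Complex.measurable_ofReal.comp h1).const_mul _)

theorem norm_expSymbol (α ε : ℝ) (η : Rn n) :
    ‖Complex.exp (Complex.I * ((ε * ‖(2 * Real.pi) • η‖ ^ α : ℝ) : ℂ))‖ = 1 := by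
  rw [mul_comm, Complex.norm_exp_ofReal_mul_I]

theorem tendsto_fourierInv_of_unimodular {ι : Type*} {l : Filter ι} [l.IsCountablyGenerated]
    {a : ι → Rn n → ℂ} {b : Rn n → ℂ} (ha : ∀ i, Measurable (a i)) (hle : ∀ i η, ‖a i η‖ ≤ 1)
    (hlim : ∀ η, Tendsto (fun i => a i η) l (𝓝 (b η))) {w : Rn n → ℂ} (hw : Integrable w) (x : Rn n) :
    Tendsto (fun i => 𝓕⁻ (fun η => a i η * w η) x) l (𝓝 (𝓕⁻ (fun η => b η * w η) x)) := by
  simp only [Real.fourierInv_eq', smul_eq_mul]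
  refine tendsto_integral_filter_of_dominated_convergence (fun η => ‖w η‖)
    (Eventually.of_forall fun i => ?_) (Eventually.of_forall fun i => ae_of_all _ fun η => ?_)
    hw.norm (ae_of_all _ fun η => ((hlim η).mul_const _).const_mul _)
  · exact (by fun_prop : Continuous _).aestronglyMeasurable.mul
      ((ha i).aestronglyMeasurable.mul hw.aestronglyMeasurable)
  · rw [norm_mul, Complex.norm_exp_ofReal_mul_I, one_mul, norm_mul]
    exact mul_le_of_le_one_left (norm_nonneg _) (hle i η)

/-- The natural choice `f = e^{-i|D|^α} g` need not be Schwartz. Its regularisation is, with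
modulation norm controlled by that of `g`, and applying `e^{i|D|^α}` to it gives functions
converging pointwise to `g` as `δ → 0`; Fatou's lemma concludes. -/
theorem schwartzEmbedsLp_of_expMultiplierBounded [hp : Fact (1 ≤ p)] {q : ℝ≥0∞} (hq : 1 ≤ q)
    (s α : ℝ) (hα₀ : 0 ≤ α) (hα₂ : α ≤ 2) {φ : 𝓢(Rn n, ℂ)} (hφ : IsWindow φ)
    (h : ExpMultiplierBounded φ α p q s) : SchwartzEmbedsLp φ p q s := by
  obtain ⟨C, hC⟩ := h
  obtain ⟨D, hD⟩ := exists_isLocalMultiplier_exp_regSq n (β := α / 2) (by linarith) (by linarith)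
  refine ⟨C * D, fun g => ?_⟩
  have hmem : ∀ᶠ δ : ℝ in 𝓝[>] 0, δ ∈ Set.Ioc (0 : ℝ) 1 :=
    Ioc_mem_nhdsGT (zero_lt_one (α := ℝ))
  have hw : Integrable (𝓕 (g : Rn n → ℂ)) := by
    rw [← SchwartzMap.fourier_coe]; exact (𝓕 g).integrable
  have hunit : ∀ (δ : ℝ) (η : Rn n),
      ‖Complex.exp (Complex.I * ((‖(2 * Real.pi) • η‖ ^ α : ℝ) : ℂ)) * regPhase (-1) δ (α / 2) η‖ ≤ 1 := by
    intro δ η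
    have := norm_expSymbol α 1 η
    rw [one_mul] at this
    rw [norm_mul, norm_regPhase, this, one_mul]
  have hmeas : ∀ δ : ℝ, Measurable fun η : Rn n =>
      Complex.exp (Complex.I * ((‖(2 * Real.pi) • η‖ ^ α : ℝ) : ℂ)) * regPhase (-1) δ (α / 2) η := by
    intro δ
    have h1 := measurable_expSymbol (n := n) α 1
    simp only [one_mul] at h1
    refine h1.mul (Complex.measurable_exp.comp ((Complex.measurable_ofReal.comp ?_).const_mul _))
    exact ((continuous_regSq δ).measurable.pow_const _).const_mul _
  refine Lp.eLpNorm_le_of_ae_tendsto (u := 𝓝[>] (0 : ℝ))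
    (f := fun δ => 𝓕⁻ (fun η : Rn n =>
      (Complex.exp (Complex.I * ((‖(2 * Real.pi) • η‖ ^ α : ℝ) : ℂ)) * regPhase (-1) δ (α / 2) η)
        * 𝓕 (g : Rn n → ℂ) η)) ?_ (fun δ => ?_) (ae_of_all _ fun x => ?_)
  · filter_upwards [hmem] with δ hδ
    have h1 := hC (SchwartzMap.fourierMultiplierCLM ℂ (regPhase (-1) δ (α / 2)) g)
    have h2 := modNorm_regPhase_le (p := p) hq s hφ hδ.1
      (fun k => hD p hp.out k δ hδ.1 hδ.2 (-1) (by simp)) g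
    rw [ENNReal.coe_mul, mul_assoc]
    refine le_trans (le_of_eq ?_) (h1.trans (mul_le_mul_right h2 _))
    rw [expMultiplier]
    congr 2
    ext η
    rw [mul_assoc]
    congr 1
    rw [← SchwartzMap.fourier_coe, ← SchwartzMap.fourier_coe,
      fourier_fourierMultiplierCLM (hasTemperateGrowth_regPhase _ hδ.1 _)]
  · exact (continuous_fourierInv (hw.bdd_mul (c := 1) (hmeas δ).aestronglyMeasurable
      (ae_of_all _ (hunit δ)))).aestronglyMeasurable
  · have h5 := tendsto_fourierInv_of_unimodular (l := 𝓝[>] (0 : ℝ)) (b := fun _ => (1 : ℂ))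
      hmeas hunit (fun η => ?_) hw x
    · simp only [one_mul] at h5
      rwa [← SchwartzMap.fourier_coe, ← SchwartzMap.fourierInv_coe,
        FourierTransform.fourierInv_fourier_eq] at h5
    · have h6 := (tendsto_regPhase hα₀ (-1) η).const_mul
        (Complex.exp (Complex.I * ((‖(2 * Real.pi) • η‖ ^ α : ℝ) : ℂ)))
      rw [← Complex.exp_add, ← mul_add, ← Complex.ofReal_add] at h6
      simpa using h6

/-- The embedding inequality is applied to the regularised `e^{i|D|^α} f`, which is Schwartz, before
letting `δ → 0`. -/
theorem expMultiplierBounded_of_schwartzEmbedsLp [hp : Fact (1 ≤ p)] {q : ℝ≥0∞} (hq : 1 ≤ q)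
    (s α : ℝ) (hα₀ : 0 ≤ α) (hα₂ : α ≤ 2) {φ : 𝓢(Rn n, ℂ)} (hφ : IsWindow φ)
    (h : SchwartzEmbedsLp φ p q s) : ExpMultiplierBounded φ α p q s := by
  obtain ⟨C, hC⟩ := h
  obtain ⟨D, hD⟩ := exists_isLocalMultiplier_exp_regSq n (β := α / 2) (by linarith) (by linarith)
  refine ⟨C * D, fun f => ?_⟩
  have hw : Integrable (𝓕 (f : Rn n → ℂ)) := by
    rw [← SchwartzMap.fourier_coe]; exact (𝓕 f).integrable
  have hmeas : ∀ δ : ℝ, Measurable (regPhase 1 δ (α / 2) : Rn n → ℂ) := fun δ =>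
    Complex.measurable_exp.comp ((Complex.measurable_ofReal.comp
      (((continuous_regSq δ).measurable.pow_const _).const_mul _)).const_mul _)
  refine Lp.eLpNorm_le_of_ae_tendsto (u := 𝓝[>] (0 : ℝ))
    (f := fun δ => 𝓕⁻ (fun η : Rn n => regPhase 1 δ (α / 2) η * 𝓕 (f : Rn n → ℂ) η))
    ?_ (fun δ => ?_) (ae_of_all _ fun x => ?_)
  · filter_upwards [Ioc_mem_nhdsGT (zero_lt_one (α := ℝ))] with δ hδ
    have h1 := hC (SchwartzMap.fourierMultiplierCLM ℂ (regPhase 1 δ (α / 2)) f)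
    have h2 := modNorm_regPhase_le (p := p) hq s hφ hδ.1
      (fun k => hD p hp.out k δ hδ.1 hδ.2 1 (by simp)) f
    rw [coe_fourierMultiplierCLM (hasTemperateGrowth_regPhase _ hδ.1 _)] at h1
    rw [ENNReal.coe_mul, mul_assoc]
    exact h1.trans (mul_le_mul_right h2 _)
  · exact (continuous_fourierInv (hw.bdd_mul (c := 1) (hmeas δ).aestronglyMeasurable
      (ae_of_all _ fun η => (norm_regPhase _ _ _ η).le))).aestronglyMeasurable
  · refine tendsto_fourierInv_of_unimodular hmeas (fun δ η => (norm_regPhase _ _ _ η).le)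
      (fun η => ?_) hw x
    simpa using tendsto_regPhase hα₀ 1 η

theorem schwartzEmbedsLp_of_modEmbedsLp [Fact (1 ≤ p)] {q : ℝ≥0∞} {s : ℝ} {φ : 𝓢(Rn n, ℂ)}
    (h : ModEmbedsLp φ p q s) : SchwartzEmbedsLp φ p q s := by
  obtain ⟨C, hC⟩ := h
  -- A positive constant is needed in the case of infinite norm, where `0 * ∞ = 0` would fail.
  refine ⟨C + 1, fun g => ?_⟩
  rcases eq_or_ne (modNorm φ p q s g) ∞ with htop | htop
  · rw [htop, ENNReal.mul_top (by simp)]; exact le_top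
  obtain ⟨G, hG, hle⟩ := hC g (lt_top_iff_ne_top.2 htop)
  have h1 : eLpNorm g p volume = ‖G‖ₑ := by rw [← distLpNorm_schwartz, ← hG, distLpNorm_coe]
  rw [h1]
  exact hle.trans (by gcongr; simp)

end SchwartzMultipliers

/-! ### Synthesis from frequency-localised pieces -/

section Synthesis

variable {n : ℕ} {p : ℝ≥0∞}

/-- A smooth frequency cutoff equal to one near the cube `[-1, 1]ⁿ`. -/
noncomputable def cubeCutoff (n : ℕ) : 𝓢(Rn n, ℂ) := cutoff (fun _ => 1) contDiff_const

theorem cubeCutoff_apply (η : Rn n) :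
    cubeCutoff n η = ((unitCubeBump n ((2 * Real.pi) • η) : ℝ) : ℂ) := by
  rw [cubeCutoff, cutoff_apply, one_mul]

/-- The smooth cutoff around the frequency cube of `k`. -/
noncomputable def cellCutoff (k : Fin n → ℤ) (η : Rn n) : ℂ := cubeCutoff n (η - freqCenter k)

theorem hasTemperateGrowth_cellCutoff (k : Fin n → ℤ) :
    (cellCutoff k).HasTemperateGrowth :=
  (cubeCutoff n).hasTemperateGrowth.comp
    (by fun_prop : Function.HasTemperateGrowth fun η : Rn n => η - freqCenter k)

theorem cellCutoff_eq_one {k : Fin n → ℤ} {η : Rn n} (hη : η ∈ freqCell k) :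
    cellCutoff k η = 1 := by
  rw [cellCutoff, cubeCutoff_apply, two_pi_smul_sub_freqCenter, unitCubeBump_eq_one]
  · simp
  · intro i; simpa [latticePt_apply] using hη i

theorem norm_lt_of_cellCutoff_ne_zero {k : Fin n → ℤ} {η : Rn n} (hη : cellCutoff k η ≠ 0) :
    ‖(2 * Real.pi) • η - latticePt k‖ < n + 2 := by
  rw [cellCutoff, cubeCutoff_apply, two_pi_smul_sub_freqCenter] at hη
  have h : (2 * Real.pi) • η - latticePt k ∈ Function.support (unitCubeBump n) := by
    intro h0
    exact hη (by rw [h0]; simp)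
  rw [(unitCubeBump n).support_eq, mem_ball_zero_iff] at h
  exact h

theorem IsWindow.mul_cellCutoff {φ : 𝓢(Rn n, ℂ)} (hφ : IsWindow φ) (k : Fin n → ℤ) :
    (cellCutoff k * fun η : Rn n => φ ((2 * Real.pi) • η - latticePt k))
      = fun η : Rn n => φ ((2 * Real.pi) • η - latticePt k) := by
  ext η
  by_cases hη : η ∈ freqCell k
  · rw [Pi.mul_apply, cellCutoff_eq_one hη, one_mul]
  · rw [Pi.mul_apply, hφ.eq_zero_of_notMem hη, mul_zero]

/-- Frequency localisation by the smooth cutoff. -/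
noncomputable def smoothBlock (k : Fin n → ℤ) : 𝓢(Rn n, ℂ) →L[ℂ] 𝓢(Rn n, ℂ) :=
  SchwartzMap.fourierMultiplierCLM ℂ (cellCutoff k)

theorem eLpNorm_smoothBlock_le (hp : 1 ≤ p) (k : Fin n → ℤ) (u : 𝓢(Rn n, ℂ)) :
    eLpNorm (smoothBlock k u) p volume ≤ kernelNorm (cubeCutoff n) * eLpNorm u p volume :=
  (IsLocalMultiplier.of_schwartz_translate (S := Set.univ) hp (cubeCutoff n)
    (freqCenter k)).eLpNorm_fourierMultiplierCLM_le (hasTemperateGrowth_cellCutoff k) u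
    (fun _ h => absurd (Set.mem_univ _) h)

/-- The window in the normalisation `ξ = 2πη`. -/
noncomputable def rescale (φ : 𝓢(Rn n, ℂ)) : 𝓢(Rn n, ℂ) :=
  SchwartzMap.compCLMOfContinuousLinearEquiv ℂ
    (ContinuousLinearEquiv.smulLeft (Units.mk0 (2 * Real.pi) (by positivity) : ℝˣ) : Rn n ≃L[ℝ] Rn n) φ

theorem rescale_apply (φ : 𝓢(Rn n, ℂ)) (k : Fin n → ℤ) (η : Rn n) :
    rescale φ (η - freqCenter k) = φ ((2 * Real.pi) • η - latticePt k) := by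
  rw [← two_pi_smul_sub_freqCenter]
  rfl

theorem eLpNorm_schwartzBlock_le (hp : 1 ≤ p) (φ : 𝓢(Rn n, ℂ)) (k : Fin n → ℤ) (u : 𝓢(Rn n, ℂ)) :
    eLpNorm (schwartzBlock φ k u) p volume ≤ kernelNorm (rescale φ) * eLpNorm u p volume := by
  have h := IsLocalMultiplier.of_schwartz_translate (S := Set.univ) hp (rescale φ) (freqCenter k)
  simp only [rescale_apply] at h
  exact h.eLpNorm_fourierMultiplierCLM_le (hasTemperateGrowth_window φ k) u
    (fun _ h => absurd (Set.mem_univ _) h)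

/-- Offsets between interacting frequency cubes. -/
noncomputable def neighbours (n : ℕ) : Finset (Fin n → ℤ) :=
  Finset.Icc (fun _ => -((n : ℤ) + 3)) (fun _ => (n : ℤ) + 3)

theorem mem_neighbours {j : Fin n → ℤ} : j ∈ neighbours n ↔ ∀ i, |(j i : ℝ)| ≤ n + 3 := by
  simp only [neighbours, Finset.mem_Icc, Pi.le_def, ← forall_and]
  refine forall_congr' fun i => ?_
  rw [abs_le]
  constructor
  · rintro ⟨h1, h2⟩; exact ⟨by exact_mod_cast h1, by exact_mod_cast h2⟩
  · rintro ⟨h1, h2⟩; exact ⟨by exact_mod_cast h1, by exact_mod_cast h2⟩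

theorem mem_neighbours_of_overlap {k l : Fin n → ℤ} {η : Rn n} (hl : η ∈ freqCell l)
    (hk : cellCutoff k η ≠ 0) : k - l ∈ neighbours n := by
  rw [mem_neighbours]
  intro i
  have h1 := hl i
  have h2 := (PiLp.norm_apply_le ((2 * Real.pi) • η - latticePt k) i).trans
    (norm_lt_of_cellCutoff_ne_zero hk).le
  simp only [PiLp.sub_apply, PiLp.smul_apply, smul_eq_mul, latticePt_apply, Real.norm_eq_abs] at h2
  rw [abs_le] at h1 h2 ⊢
  simp only [Pi.sub_apply]
  push_cast
  constructor <;> linarith [h1.1, h1.2, h2.1, h2.2]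

theorem schwartzBlock_smoothBlock_eq_zero {φ : 𝓢(Rn n, ℂ)} (hφ : IsWindow φ) {k l : Fin n → ℤ}
    (h : k - l ∉ neighbours n) (u : 𝓢(Rn n, ℂ)) : schwartzBlock φ l (smoothBlock k u) = 0 := by
  rw [schwartzBlock, smoothBlock, SchwartzMap.fourierMultiplierCLM_fourierMultiplierCLM_apply
    (hasTemperateGrowth_window φ l) (hasTemperateGrowth_cellCutoff k)]
  have : ((fun η : Rn n => φ ((2 * Real.pi) • η - latticePt l)) * cellCutoff k)
      = fun _ => (0 : ℂ) := by
    ext η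
    rw [Pi.mul_apply]
    by_cases hη : η ∈ freqCell l
    · by_cases hk : cellCutoff k η = 0
      · rw [hk, mul_zero]
      · exact absurd (mem_neighbours_of_overlap hη hk) h
    · rw [hφ.eq_zero_of_notMem hη, zero_mul]
  rw [this]
  simp

theorem one_add_norm_sq_le_of_neighbours {k l : Fin n → ℤ} (h : k - l ∈ neighbours n) :
    1 + ‖latticePt l‖ ^ 2 ≤ 2 * (1 + n * (n + 3) ^ 2) * (1 + ‖latticePt k‖ ^ 2) ∧
    1 + ‖latticePt k‖ ^ 2 ≤ 2 * (1 + n * (n + 3) ^ 2) * (1 + ‖latticePt l‖ ^ 2) := by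
  have hd : ∑ i, ((k i : ℝ) - l i) ^ 2 ≤ n * ((n : ℝ) + 3) ^ 2 := by
    calc ∑ i, ((k i : ℝ) - l i) ^ 2 ≤ ∑ _i : Fin n, ((n : ℝ) + 3) ^ 2 := by
          refine Finset.sum_le_sum fun i _ => ?_
          have := mem_neighbours.1 h i
          simp only [Pi.sub_apply, Int.cast_sub] at this
          exact sq_le_sq' (by linarith [(_root_.abs_le.1 this).1]) (_root_.abs_le.1 this).2
      _ = _ := by simp
  have hkl : ∀ a b : Fin n → ℤ, ∑ i, ((a i : ℝ) - b i) ^ 2 ≤ n * ((n : ℝ) + 3) ^ 2 →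
      1 + ‖latticePt a‖ ^ 2 ≤ 2 * (1 + n * (n + 3) ^ 2) * (1 + ‖latticePt b‖ ^ 2) := by
    intro a b hab
    have h1 : ‖latticePt a‖ ^ 2 ≤ 2 * ‖latticePt b‖ ^ 2 + 2 * ∑ i, ((a i : ℝ) - b i) ^ 2 := by
      rw [norm_sq_latticePt, norm_sq_latticePt, Finset.mul_sum, Finset.mul_sum,
        ← Finset.sum_add_distrib]
      refine Finset.sum_le_sum fun i _ => ?_
      nlinarith [sq_nonneg ((a i : ℝ) - 2 * b i)]
    have h2 : 0 ≤ ‖latticePt b‖ ^ 2 := by positivity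
    have h3 : (0 : ℝ) ≤ n * ((n : ℝ) + 3) ^ 2 := by positivity
    nlinarith [mul_nonneg h2 h3]
  refine ⟨hkl l k ?_, hkl k l hd⟩
  simpa only [sub_sq_comm] using hd

/-- A Peetre-type inequality: `1 + |k|²` and `1 + |l|²` are comparable in both directions, and the
sign of `s` decides which direction is used. -/
theorem exists_weight_le (n : ℕ) (s : ℝ) : ∃ W : ℝ≥0, ∀ k l : Fin n → ℤ, k - l ∈ neighbours n →
    weight s l ≤ W * weight s k := by
  set P : ℝ := 2 * (1 + n * (n + 3) ^ 2) with hP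
  have hP0 : 0 < P := by positivity
  refine ⟨(P ^ (|s| / 2)).toNNReal, fun k l h => ?_⟩
  obtain ⟨h1, h2⟩ := one_add_norm_sq_le_of_neighbours h
  rw [weight, weight, ← ENNReal.ofReal.eq_1, ← ENNReal.ofReal_mul (by positivity)]
  refine ENNReal.ofReal_le_ofReal ?_
  rcases le_total 0 s with hs | hs
  · rw [abs_of_nonneg hs, ← Real.mul_rpow hP0.le (by positivity)]
    exact Real.rpow_le_rpow (by positivity) h1 (by positivity)
  · rw [abs_of_nonpos hs]
    have h3 : (P * (1 + ‖latticePt l‖ ^ 2)) ^ (s / 2) ≤ (1 + ‖latticePt k‖ ^ 2) ^ (s / 2) :=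
      Real.rpow_le_rpow_of_nonpos (by positivity) h2 (by linarith)
    rw [Real.mul_rpow hP0.le (by positivity)] at h3
    have h4 : P ^ (-s / 2) * P ^ (s / 2) = 1 := by
      rw [← Real.rpow_add hP0]; ring_nf; simp
    calc (1 + ‖latticePt l‖ ^ 2) ^ (s / 2)
        = P ^ (-s / 2) * (P ^ (s / 2) * (1 + ‖latticePt l‖ ^ 2) ^ (s / 2)) := by
          rw [← mul_assoc, h4, one_mul]
      _ ≤ _ := by gcongr

/-- Synthesis bound: a finite sum of frequency localised Schwartz functions. -/
theorem exists_modNorm_sum_le [hp : Fact (1 ≤ p)] {q : ℝ≥0∞} (hq : 1 ≤ q) (s : ℝ)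
    {φ : 𝓢(Rn n, ℂ)} (hφ : IsWindow φ) :
    ∃ A : ℝ≥0, ∀ (F : Finset (Fin n → ℤ)) (u : (Fin n → ℤ) → 𝓢(Rn n, ℂ)),
      modNorm φ p q s ((∑ k ∈ F, smoothBlock k (u k) : 𝓢(Rn n, ℂ)) : 𝓢'(Rn n, ℂ))
        ≤ A * seqNorm q (fun k => weight s k * eLpNorm (u k) p volume) := by
  classical
  obtain ⟨W, hW⟩ := exists_weight_le n s
  set M : ℝ≥0 := kernelNorm (rescale φ) * kernelNorm (cubeCutoff n) with hM
  refine ⟨W * M * (neighbours n).card, fun F u => ?_⟩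
  set a : (Fin n → ℤ) → ℝ≥0∞ := fun k => weight s k * eLpNorm (u k) p volume with ha
  have hb : ∀ l, blockNorm φ p s ((∑ k ∈ F, smoothBlock k (u k) : 𝓢(Rn n, ℂ)) : 𝓢'(Rn n, ℂ)) l
      ≤ (W * M : ℝ≥0) * ∑ j ∈ neighbours n, a (l + j) := by
    intro l
    rw [blockNorm_schwartz]
    have h1 : eLpNorm (schwartzBlock φ l (∑ k ∈ F, smoothBlock k (u k))) p volume
        ≤ ∑ k ∈ F, eLpNorm (schwartzBlock φ l (smoothBlock k (u k))) p volume := by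
      rw [map_sum]
      have : ((∑ k ∈ F, schwartzBlock φ l (smoothBlock k (u k)) : 𝓢(Rn n, ℂ)) : Rn n → ℂ)
          = ∑ k ∈ F, (schwartzBlock φ l (smoothBlock k (u k)) : Rn n → ℂ) := by
        ext x; simp
      rw [this]
      exact eLpNorm_sum_le (fun k _ => (SchwartzMap.continuous _).aestronglyMeasurable) hp.out
    -- Only pieces with `k - l ∈ neighbours n` meet the cube of `l`, so the number of terms does not
    -- depend on `F`.
    have h2 : ∑ k ∈ F, eLpNorm (schwartzBlock φ l (smoothBlock k (u k))) p volume
        ≤ ∑ k ∈ (neighbours n).map (addLeftEmbedding l),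
          eLpNorm (schwartzBlock φ l (smoothBlock k (u k))) p volume := by
      refine Finset.sum_le_sum_of_ne_zero fun k _ hk => ?_
      rw [Finset.mem_map]
      by_contra hc
      refine hk ?_
      rw [schwartzBlock_smoothBlock_eq_zero hφ (fun hkl => hc ⟨k - l, hkl, by simp⟩)]
      simp
    rw [Finset.sum_map] at h2
    calc weight s l * _ ≤ weight s l * ∑ j ∈ neighbours n,
          eLpNorm (schwartzBlock φ l (smoothBlock (l + j) (u (l + j)))) p volume := by
          gcongr; exact h1.trans h2
      _ ≤ ∑ j ∈ neighbours n, (W * M : ℝ≥0) * a (l + j) := by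
          rw [Finset.mul_sum]
          refine Finset.sum_le_sum fun j hj => ?_
          have h3 : eLpNorm (schwartzBlock φ l (smoothBlock (l + j) (u (l + j)))) p volume
              ≤ M * eLpNorm (u (l + j)) p volume := by
            rw [hM, ENNReal.coe_mul, mul_assoc]
            exact (eLpNorm_schwartzBlock_le hp.out φ l _).trans
              (mul_le_mul_right (eLpNorm_smoothBlock_le hp.out _ _) _)
          have h4 := hW (l + j) l (by simpa using hj)
          calc _ ≤ (W * weight s (l + j)) * (M * eLpNorm (u (l + j)) p volume) :=
                mul_le_mul' h4 h3
            _ = _ := by rw [ha, ENNReal.coe_mul W M]; ring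
      _ = _ := by rw [Finset.mul_sum]
  rw [modNorm_eq_seqNorm]
  calc _ ≤ seqNorm q (fun l => ((W * M : ℝ≥0) : ℝ≥0∞) * ∑ j ∈ neighbours n, a (l + j)) :=
        seqNorm_mono hb
    _ = (W * M : ℝ≥0) * seqNorm q (fun l => ∑ j ∈ neighbours n, a (l + j)) :=
        seqNorm_const_mul hq _ _
    _ ≤ (W * M : ℝ≥0) * ((neighbours n).card * seqNorm q a) := by
        gcongr; exact seqNorm_sum_neighbours_le hq _ a
    _ = _ := by push_cast; ring

theorem SchwartzEmbedsLp.exists_eLpNorm_sum_le [hp : Fact (1 ≤ p)] {q : ℝ≥0∞} (hq : 1 ≤ q) {s : ℝ}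
    {φ : 𝓢(Rn n, ℂ)} (hφ : IsWindow φ) (h : SchwartzEmbedsLp φ p q s) :
    ∃ A : ℝ≥0, ∀ (F : Finset (Fin n → ℤ)) (u : (Fin n → ℤ) → 𝓢(Rn n, ℂ)),
      eLpNorm (∑ k ∈ F, smoothBlock k (u k) : 𝓢(Rn n, ℂ)) p volume
        ≤ A * seqNorm q (fun k => weight s k * eLpNorm (u k) p volume) := by
  obtain ⟨C, hC⟩ := h
  obtain ⟨A, hA⟩ := exists_modNorm_sum_le (p := p) hq s hφ
  refine ⟨C * A, fun F u => (hC _).trans ?_⟩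
  rw [ENNReal.coe_mul, mul_assoc]
  gcongr
  exact hA F u

/-- The set where the essential bound holds is closed, and dense because it has full measure. -/
theorem enorm_le_eLpNorm_top {f : Rn n → ℂ} (hf : Continuous f) (x : Rn n) :
    ‖f x‖ₑ ≤ eLpNorm f ∞ volume := by
  rw [eLpNorm_exponent_top]
  have h1 : ∀ᵐ y : Rn n, ‖f y‖ₑ ≤ eLpNormEssSup f volume := enorm_ae_le_eLpNormEssSup f _
  have h2 := Measure.dense_of_ae h1
  have h3 : IsClosed {y : Rn n | ‖f y‖ₑ ≤ eLpNormEssSup f volume} :=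
    isClosed_le hf.enorm continuous_const
  have h4 : {y : Rn n | ‖f y‖ₑ ≤ eLpNormEssSup f volume} = Set.univ := by
    rw [← h3.closure_eq]; exact h2.closure_eq
  exact (Set.eq_univ_iff_forall.1 h4) x

theorem enorm_fourierInv_le (w : Rn n → ℂ) (x : Rn n) : ‖𝓕⁻ w x‖ₑ ≤ ∫⁻ η, ‖w η‖ₑ := by
  rw [Real.fourierInv_eq']
  refine (enorm_integral_le_lintegral_enorm _).trans (le_of_eq (lintegral_congr fun η => ?_))
  rw [enorm_smul, ← ofReal_norm (Complex.exp _), Complex.norm_exp_ofReal_mul_I]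
  simp

/-- For `p = ∞` the embedding controls `ℓ¹` sums of block norms. -/
theorem SchwartzEmbedsLp.exists_sum_le_of_top {q : ℝ≥0∞} (hq : 1 ≤ q) {s : ℝ}
    {φ : 𝓢(Rn n, ℂ)} (hφ : IsWindow φ) (h : SchwartzEmbedsLp φ ∞ q s) :
    ∃ A : ℝ≥0, ∀ (F : Finset (Fin n → ℤ)) (c : (Fin n → ℤ) → ℝ≥0),
      ∑ k ∈ F, (c k : ℝ≥0∞) ≤ A * seqNorm q (fun k => weight s k * c k) := by
  obtain ⟨A, hA⟩ := h.exists_eLpNorm_sum_le hq hφ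
  set κ := cubeCutoff n with hκ
  set I₁ := ∫⁻ η, ‖κ η‖ₑ with hI₁
  have hI₁t : I₁ ≠ ∞ := κ.integrable.2.ne
  set I₂ : ℝ := ∫ η, (unitCubeBump n ((2 * Real.pi) • η)) ^ 2 with hI₂
  have hcont : Continuous fun η : Rn n => (unitCubeBump n ((2 * Real.pi) • η)) ^ 2 :=
    (((unitCubeBump n).continuous.comp (continuous_const_smul _)).pow 2)
  have hsq : ∀ η, ((unitCubeBump n ((2 * Real.pi) • η) ^ 2 : ℝ) : ℂ) = κ η * κ η := fun η => by
    rw [hκ, cubeCutoff_apply]; push_cast; ring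
  have hI₂i : Integrable fun η : Rn n => (unitCubeBump n ((2 * Real.pi) • η)) ^ 2 := by
    have h1 : Integrable fun η => κ η * κ η :=
      κ.integrable.bdd_mul (c := ‖κ.toBoundedContinuousFunction‖) κ.continuous.aestronglyMeasurable
        (ae_of_all _ fun η => κ.toBoundedContinuousFunction.norm_coe_le_norm η)
    simp only [← hsq] at h1
    exact h1.re
  have hI₂0 : 0 < I₂ := by
    rw [hI₂, integral_pos_iff_support_of_nonneg (fun _ => sq_nonneg _) hI₂i]
    refine (hcont.isOpen_support).measure_pos _ ⟨0, ?_⟩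
    simp [unitCubeBump_eq_one (n := n) (x := 0) (by simp)]
  refine ⟨(I₂⁻¹).toNNReal * A * I₁.toNNReal, fun F c => ?_⟩
  set σ : (Fin n → ℤ) → 𝓢(Rn n, ℂ) := fun k => SchwartzMap.compSubConstCLM ℂ (freqCenter k) κ with hσ
  have hσa : ∀ k η, σ k η = cellCutoff k η := fun k η => rfl
  have hJint : ∀ k : Fin n → ℤ, ∫ η, cellCutoff k η * cellCutoff k η = (I₂ : ℂ) := by
    intro k
    simp only [cellCutoff]
    rw [integral_sub_right_eq_self (fun η => cubeCutoff n η * cubeCutoff n η) (freqCenter k)]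
    simp only [← hκ, ← hsq]
    exact integral_ofReal
  -- Localising `u k` squares the cutoff, so at the origin each piece takes the value `c k * I₂`
  -- with `I₂ > 0`: the values add without cancellation, while `‖u k‖_∞ ≤ I₁ * c k`.
  set u : (Fin n → ℤ) → 𝓢(Rn n, ℂ) := fun k => (c k : ℂ) • 𝓕⁻ (σ k) with hu
  have hval : ∀ k, smoothBlock k (u k) 0 = (c k : ℂ) * I₂ := by
    intro k
    rw [hu, smoothBlock, map_smul, smul_apply,
      coe_fourierMultiplierCLM (hasTemperateGrowth_cellCutoff k), ← SchwartzMap.fourier_coe,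
      FourierTransform.fourier_fourierInv_eq, Real.fourierInv_eq']
    simp only [inner_zero_right, mul_zero, Complex.ofReal_zero, zero_mul, Complex.exp_zero,
      one_mul, hσa, smul_eq_mul]
    rw [hJint]
  have hun : ∀ k, eLpNorm (u k) ∞ volume ≤ I₁.toNNReal * c k := by
    intro k
    rw [eLpNorm_exponent_top]
    refine eLpNormEssSup_le_of_ae_enorm_bound (ae_of_all _ fun x => ?_)
    rw [hu, smul_apply, enorm_smul, mul_comm, ENNReal.coe_toNNReal hI₁t,
      SchwartzMap.fourierInv_coe]
    have h1 : ∫⁻ η, ‖σ k η‖ₑ = I₁ := by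
      simp only [hσa, cellCutoff]
      exact lintegral_sub_right_eq_self (fun η => ‖cubeCutoff n η‖ₑ) (freqCenter k)
    have h2 : ‖((c k : ℝ) : ℂ)‖ₑ = c k := by
      rw [← ofReal_norm, Complex.norm_real]; simp
    rw [h2]
    gcongr
    rw [← h1]
    exact enorm_fourierInv_le _ _
  have h3 := (enorm_le_eLpNorm_top (SchwartzMap.continuous (∑ k ∈ F, smoothBlock k (u k))) 0).trans
    (hA F u)
  have h4 : (∑ k ∈ F, smoothBlock k (u k) : 𝓢(Rn n, ℂ)) 0 = (((∑ k ∈ F, (c k : ℝ)) * I₂ : ℝ) : ℂ) := by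
    rw [sum_apply, Finset.sum_congr rfl fun k _ => hval k, ← Finset.sum_mul]
    push_cast; rfl
  have h5 : ‖(((∑ k ∈ F, (c k : ℝ)) * I₂ : ℝ) : ℂ)‖ₑ = (∑ k ∈ F, (c k : ℝ≥0∞)) * ENNReal.ofReal I₂ := by
    have h0 : 0 ≤ ∑ k ∈ F, (c k : ℝ) := Finset.sum_nonneg fun k _ => (c k).2
    rw [← ofReal_norm, Complex.norm_real, Real.norm_of_nonneg (by positivity),
      ENNReal.ofReal_mul h0, ← NNReal.coe_sum, ENNReal.ofReal_coe_nnreal, ENNReal.ofNNReal_finsetSum]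
  rw [h4, h5] at h3
  have h6 : seqNorm q (fun k => weight s k * eLpNorm (u k) ∞ volume)
      ≤ I₁.toNNReal * seqNorm q (fun k => weight s k * c k) := by
    rw [← seqNorm_const_mul hq]
    refine seqNorm_mono fun k => ?_
    calc _ ≤ weight s k * (I₁.toNNReal * c k) := by gcongr; exact hun k
      _ = _ := by ring
  have h7 : ENNReal.ofReal I₂ * ENNReal.ofReal I₂⁻¹ = 1 := by
    rw [← ENNReal.ofReal_mul hI₂0.le, mul_inv_cancel₀ hI₂0.ne', ENNReal.ofReal_one]
  calc ∑ k ∈ F, (c k : ℝ≥0∞)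
      = (∑ k ∈ F, (c k : ℝ≥0∞)) * ENNReal.ofReal I₂ * ENNReal.ofReal I₂⁻¹ := by
        rw [mul_assoc, h7, mul_one]
    _ ≤ (A * (I₁.toNNReal * seqNorm q (fun k => weight s k * c k))) * ENNReal.ofReal I₂⁻¹ := by
        exact mul_le_mul' (h3.trans (mul_le_mul_right h6 _)) le_rfl
    _ = _ := by rw [ENNReal.coe_mul, ENNReal.coe_mul, ← ENNReal.ofReal.eq_1]; ring

end Synthesis

/-! ### Frequency blocks in `L^p` and their Schwartz approximation -/

section LpBlocks

variable {n : ℕ} {p : ℝ≥0∞} [hp : Fact (1 ≤ p)]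

theorem enorm_toLp (v : 𝓢(Rn n, ℂ)) : ‖v.toLp p volume‖ₑ = eLpNorm v p volume := by
  rw [Lp.enorm_def]
  exact eLpNorm_congr_ae (SchwartzMap.coeFn_toLp v p volume)

/-- The frequency blocks of an element of the modulation space, as `L^p` functions. -/
theorem exists_lp_blocks {q : ℝ≥0∞} (hq : 1 ≤ q) {s : ℝ} {φ : 𝓢(Rn n, ℂ)} {f : 𝓢'(Rn n, ℂ)}
    (hf : f ∈ modSpace φ p q s) :
    ∃ b : (Fin n → ℤ) → Lp ℂ p (volume : Measure (Rn n)),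
      (∀ k, (b k : 𝓢'(Rn n, ℂ)) = freqBlock φ k f) ∧
      modNorm φ p q s f = seqNorm q (fun k => weight s k * ‖b k‖ₑ) := by
  have h1 : ∀ k, ∃ g : Lp ℂ p (volume : Measure (Rn n)), (g : 𝓢'(Rn n, ℂ)) = freqBlock φ k f := by
    intro k
    have h2 : blockNorm φ p s f k < ∞ :=
      (le_seqNorm hq (blockNorm φ p s f) k).trans_lt hf
    by_contra! hc
    have h3 : distLpNorm p (freqBlock φ k f) = ∞ := by
      rw [distLpNorm]
      simp [hc]
    rw [blockNorm, h3, ENNReal.mul_top] at h2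
    · exact lt_irrefl _ h2
    · rw [Ne, ENNReal.ofReal_eq_zero, not_le]
      positivity
  choose b hb using h1
  refine ⟨b, hb, ?_⟩
  rw [modNorm_eq_seqNorm]
  congr 1
  ext k
  rw [blockNorm, ← hb k, distLpNorm_coe]
  rfl

/-- The smooth frequency localisation on `L^p`. -/
noncomputable def lpSmoothBlock (p : ℝ≥0∞) [Fact (1 ≤ p)] (k : Fin n → ℤ) :
    Lp ℂ p (volume : Measure (Rn n)) →L[ℂ] Lp ℂ p (volume : Measure (Rn n)) :=
  LinearMap.extendOfNorm
    ((SchwartzMap.toLpCLM ℂ ℂ p volume).toLinearMap ∘ₗ (smoothBlock k).toLinearMap)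
    (SchwartzMap.toLpCLM ℂ ℂ p volume).toLinearMap

theorem lpSmoothBlock_toLp (hp' : p ≠ ∞) (k : Fin n → ℤ) (u : 𝓢(Rn n, ℂ)) :
    lpSmoothBlock p k (u.toLp p volume) = (smoothBlock k u).toLp p volume := by
  refine LinearMap.extendOfNorm_eq
    (f := (SchwartzMap.toLpCLM ℂ ℂ p volume).toLinearMap ∘ₗ (smoothBlock k).toLinearMap)
    (e := (SchwartzMap.toLpCLM ℂ ℂ p volume).toLinearMap)
    (SchwartzMap.denseRange_toLpCLM (F := ℂ) hp') ⟨kernelNorm (cubeCutoff n), fun w => ?_⟩ u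
  have h := eLpNorm_smoothBlock_le hp.out k w
  rw [← enorm_toLp, ← enorm_toLp, enorm_eq_nnnorm, enorm_eq_nnnorm] at h
  exact_mod_cast h

theorem coe_lpSmoothBlock (hp' : p ≠ ∞) (k : Fin n → ℤ) (g : Lp ℂ p (volume : Measure (Rn n))) :
    (lpSmoothBlock p k g : 𝓢'(Rn n, ℂ))
      = TemperedDistribution.fourierMultiplierCLM ℂ (cellCutoff k) (g : 𝓢'(Rn n, ℂ)) := by
  refine DenseRange.induction_on
    (p := fun g : Lp ℂ p (volume : Measure (Rn n)) => (lpSmoothBlock p k g : 𝓢'(Rn n, ℂ))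
      = TemperedDistribution.fourierMultiplierCLM ℂ (cellCutoff k) (g : 𝓢'(Rn n, ℂ)))
    (SchwartzMap.denseRange_toLpCLM (F := ℂ) (μ := (volume : Measure (Rn n))) hp') g ?_ fun u => ?_
  · exact isClosed_eq
      ((Lp.toTemperedDistributionCLM ℂ volume p).continuous.comp (lpSmoothBlock p k).continuous)
      ((TemperedDistribution.fourierMultiplierCLM ℂ (cellCutoff k)).continuous.comp
        (Lp.toTemperedDistributionCLM ℂ volume p).continuous)
  · rw [SchwartzMap.toLpCLM_apply, lpSmoothBlock_toLp hp', Lp.toTemperedDistribution_toLp_eq,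
      Lp.toTemperedDistribution_toLp_eq,
      TemperedDistribution.fourierMultiplierCLM_toTemperedDistributionCLM_eq
        (hasTemperateGrowth_cellCutoff k)]
    rfl

/-- The cutoff is one where the window lives. This reproducing identity makes localised approximants
of a block converge to the block itself. -/
theorem lpSmoothBlock_eq_self (hp' : p ≠ ∞) {φ : 𝓢(Rn n, ℂ)} (hφ : IsWindow φ) {k : Fin n → ℤ}
    {f : 𝓢'(Rn n, ℂ)} {g : Lp ℂ p (volume : Measure (Rn n))}
    (hg : (g : 𝓢'(Rn n, ℂ)) = freqBlock φ k f) : lpSmoothBlock p k g = g := by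
  apply toTemperedDistribution_injective
  rw [coe_lpSmoothBlock hp', hg, freqBlock,
    TemperedDistribution.fourierMultiplierCLM_fourierMultiplierCLM_apply
      (hasTemperateGrowth_window φ k) (hasTemperateGrowth_cellCutoff k), mul_comm,
    hφ.mul_cellCutoff]

/-- Take `u` Schwartz and close to `g`; since localisation is continuous and fixes `g`, the
localised `u` is close as well. The factor 2 makes the size condition open around `g ≠ 0`, which is
why `g = 0` is separate. -/
theorem exists_smoothBlock_approx (hp' : p ≠ ∞) {k : Fin n → ℤ}
    {g : Lp ℂ p (volume : Measure (Rn n))} (hg : lpSmoothBlock p k g = g) {ε : ℝ} (hε : 0 < ε) :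
    ∃ u : 𝓢(Rn n, ℂ), eLpNorm u p volume ≤ 2 * ‖g‖ₑ ∧
      ‖(smoothBlock k u).toLp p volume - g‖ < ε := by
  rcases eq_or_ne g 0 with rfl | hg0
  · refine ⟨0, by simp, ?_⟩
    have : (smoothBlock k (0 : 𝓢(Rn n, ℂ))).toLp p volume = 0 := by
      rw [map_zero]; exact map_zero (SchwartzMap.toLpCLM ℂ ℂ p (volume : Measure (Rn n)))
    rw [this]; simpa using hε
  have hd := SchwartzMap.denseRange_toLpCLM (F := ℂ) (μ := (volume : Measure (Rn n))) hp'
  have h1 : {x : Lp ℂ p (volume : Measure (Rn n)) | ‖lpSmoothBlock p k x - g‖ < ε ∧ ‖x‖ < 2 * ‖g‖}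
      ∈ 𝓝 g := by
    have hn : 0 < ‖g‖ := norm_pos_iff.2 hg0
    refine IsOpen.mem_nhds (IsOpen.and ?_ ?_) ⟨by rw [hg]; simpa using hε, by linarith⟩
    · exact isOpen_lt (by fun_prop) continuous_const
    · exact isOpen_lt continuous_norm continuous_const
  obtain ⟨u, hu1, hu2⟩ := hd.exists_mem_open isOpen_interior ⟨g, mem_interior_iff_mem_nhds.2 h1⟩ |>.imp
    fun u hu => interior_subset hu
  rw [SchwartzMap.toLpCLM_apply] at hu1 hu2
  rw [lpSmoothBlock_toLp hp'] at hu1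
  refine ⟨u, ?_, hu1⟩
  rw [← enorm_toLp, enorm_eq_nnnorm, enorm_eq_nnnorm]
  exact_mod_cast hu2.le

end LpBlocks

/-! ### Translations and asymptotic additivity of `L^r` mass -/

section Translation

variable {n : ℕ} {p : ℝ≥0∞}

theorem fourier_compSubConst (x : Rn n) (v : 𝓢(Rn n, ℂ)) (η : Rn n) :
    𝓕 (SchwartzMap.compSubConstCLM ℂ x v) η
      = Complex.exp (((-2 * Real.pi * inner ℝ x η : ℝ) : ℂ) * Complex.I) * 𝓕 v η := by
  rw [SchwartzMap.fourier_coe, SchwartzMap.fourier_coe, Real.fourier_eq', Real.fourier_eq']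
  symm
  rw [← integral_const_mul, ← integral_sub_right_eq_self _ x]
  refine integral_congr_ae (ae_of_all _ fun y => ?_)
  simp only [SchwartzMap.compSubConstCLM_apply, smul_eq_mul, ← mul_assoc, ← Complex.exp_add,
    inner_sub_left]
  congr 2
  push_cast
  ring

theorem smoothBlock_compSubConst (k : Fin n → ℤ) (x : Rn n) (v : 𝓢(Rn n, ℂ)) :
    smoothBlock k (SchwartzMap.compSubConstCLM ℂ x v)
      = SchwartzMap.compSubConstCLM ℂ x (smoothBlock k v) := by
  apply (FourierTransform.fourierEquiv ℂ 𝓢(Rn n, ℂ)).injective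
  ext η
  simp only [FourierTransform.fourierEquiv_apply]
  rw [fourier_compSubConst, smoothBlock,
    fourier_fourierMultiplierCLM (hasTemperateGrowth_cellCutoff k),
    fourier_fourierMultiplierCLM (hasTemperateGrowth_cellCutoff k), fourier_compSubConst]
  ring

theorem eLpNorm_compSubConst (x : Rn n) (v : 𝓢(Rn n, ℂ)) :
    eLpNorm (SchwartzMap.compSubConstCLM ℂ x v) p volume = eLpNorm v p volume :=
  eLpNorm_comp_measurePreserving v.continuous.aestronglyMeasurable
    (measurePreserving_sub_right volume x)

theorem exists_lt_setLIntegral_ball {f : Rn n → ℝ≥0∞} {a : ℝ≥0∞} (h : a < ∫⁻ y, f y) :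
    ∃ R : ℕ, a < ∫⁻ y in Metric.ball 0 R, f y := by
  have h1 : ∫⁻ y, f y = ⨆ R : ℕ, ∫⁻ y in Metric.ball 0 R, f y := by
    rw [← setLIntegral_iUnion_of_directed, Metric.iUnion_ball_nat, setLIntegral_univ]
    exact (monotone_nat_of_le_succ fun m =>
      Metric.ball_subset_ball (by push_cast; linarith)).directed_le
  rw [h1] at h
  exact lt_iSup_iff.1 h

/-- The `L^r` mass on a bounded set is not affected by a bump escaping to infinity. -/
theorem tendsto_setLIntegral_add_translate {r : ℝ} (hr : 0 < r) (u v : 𝓢(Rn n, ℂ)) (R : ℝ)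
    {x : ℕ → Rn n} (hx : Tendsto x atTop (cocompact (Rn n))) :
    Tendsto (fun m => ∫⁻ y in Metric.ball 0 R, ‖u y + v (y - x m)‖ₑ ^ r) atTop
      (𝓝 (∫⁻ y in Metric.ball 0 R, ‖u y‖ₑ ^ r)) := by
  have hb : ∀ w : 𝓢(Rn n, ℂ), ∃ c : ℝ≥0, ∀ y, ‖w y‖ₑ ≤ c := fun w =>
    ⟨‖w.toBoundedContinuousFunction‖₊, fun y => by
      rw [enorm_eq_nnnorm]
      exact_mod_cast w.toBoundedContinuousFunction.norm_coe_le_norm y⟩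
  obtain ⟨c, hc⟩ := hb u
  obtain ⟨d, hd⟩ := hb v
  refine tendsto_lintegral_of_dominated_convergence (fun _ => ((c + d : ℝ≥0) : ℝ≥0∞) ^ r)
    (fun m => ?_) (fun m => ae_of_all _ fun y => ?_) ?_ (ae_of_all _ fun y => ?_)
  · exact ((u.continuous.add (v.continuous.comp (continuous_sub_right _))).enorm.measurable).pow_const r
  · refine ENNReal.rpow_le_rpow ((enorm_add_le _ _).trans ?_) hr.le
    push_cast
    exact add_le_add (hc _) (hd _)
  · rw [setLIntegral_const]
    exact ENNReal.mul_ne_top (ENNReal.rpow_ne_top_of_nonneg hr.le ENNReal.coe_ne_top)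
      measure_ball_lt_top.ne
  · have h1 : Tendsto (fun m => y - x m) atTop (cocompact (Rn n)) := by
      have := (Homeomorph.subLeft y).isClosedEmbedding.tendsto_cocompact.comp hx
      exact this
    have h2 : Tendsto (fun m => v (y - x m)) atTop (𝓝 0) :=
      v.toZeroAtInfty.zero_at_infty'.comp h1
    have h3 := ((h2.const_add (u y)).enorm).ennrpow_const r
    simpa using h3

/-- Nearly all the mass of `u` and of `v` lies in balls. Once `v` is moved far away, each function
is negligible on the ball of the other and the balls are disjoint. Room to escape to infinity
requires `n ≥ 1`. -/
theorem exists_lt_lintegral_add_translate (hn : 1 ≤ n) {r : ℝ} (hr : 0 < r) {u v : 𝓢(Rn n, ℂ)}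
    {a b : ℝ≥0∞} (ha : a < ∫⁻ y, ‖u y‖ₑ ^ r) (hb : b < ∫⁻ y, ‖v y‖ₑ ^ r) :
    ∃ x : Rn n, a + b < ∫⁻ y, ‖(u + SchwartzMap.compSubConstCLM ℂ x v) y‖ₑ ^ r := by
  obtain ⟨R₁, hR₁⟩ := exists_lt_setLIntegral_ball ha
  obtain ⟨R₂, hR₂⟩ := exists_lt_setLIntegral_ball hb
  set e : Rn n := EuclideanSpace.single ⟨0, hn⟩ 1 with he
  have hnorm : ∀ m : ℕ, ‖(m : ℝ) • e‖ = m := fun m => by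
    rw [norm_smul, he, PiLp.norm_single]; simp
  have hx : Tendsto (fun m : ℕ => (m : ℝ) • e) atTop (cocompact (Rn n)) := by
    rw [← Metric.cobounded_eq_cocompact, ← tendsto_norm_atTop_iff_cobounded]
    simp only [hnorm]
    exact tendsto_natCast_atTop_atTop
  have hx' : Tendsto (fun m : ℕ => -((m : ℝ) • e)) atTop (cocompact (Rn n)) :=
    (Homeomorph.neg (Rn n)).isClosedEmbedding.tendsto_cocompact.comp hx
  have h1 := (tendsto_setLIntegral_add_translate hr u v R₁ hx).eventually (lt_mem_nhds hR₁)
  have h2 := (tendsto_setLIntegral_add_translate hr v u R₂ hx').eventually (lt_mem_nhds hR₂)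
  obtain ⟨m, h1, h2, hm⟩ := (h1.and (h2.and (eventually_ge_atTop (R₁ + R₂)))).exists
  refine ⟨(m : ℝ) • e, (ENNReal.add_lt_add h1 h2).trans_le ?_⟩
  set x := (m : ℝ) • e with hxd
  -- The second limit was taken in the frame of `v`, with `u` moving by `-x`; this returns it to the
  -- frame of `u`.
  have h3 : ∫⁻ y in Metric.ball 0 R₂, ‖v y + u (y - -x)‖ₑ ^ r
      = ∫⁻ y in Metric.ball x R₂, ‖u y + v (y - x)‖ₑ ^ r := by
    rw [← lintegral_indicator Metric.isOpen_ball.measurableSet,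
      ← lintegral_indicator Metric.isOpen_ball.measurableSet,
      ← lintegral_sub_right_eq_self _ x]
    refine lintegral_congr fun y => ?_
    simp only [Set.indicator, Metric.mem_ball, dist_eq_norm, sub_neg_eq_add,
      sub_add_cancel, sub_zero, add_comm (v _)]
  rw [h3, ← lintegral_union Metric.isOpen_ball.measurableSet]
  · exact setLIntegral_le_lintegral _ _
  · refine Metric.ball_disjoint_ball ?_
    rw [dist_comm, dist_zero_right, hnorm]
    exact_mod_cast hm

end Translation

/-! ### Unconditional summability of the blocks -/

section Summability

variable {n : ℕ} {p : ℝ≥0∞}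

/-- Sums of frequency localised Schwartz functions with frequencies in `F` and prescribed sizes. -/
def IsBlockSum (p : ℝ≥0∞) (c : (Fin n → ℤ) → ℝ≥0∞) (F : Finset (Fin n → ℤ)) (v : 𝓢(Rn n, ℂ)) :
    Prop :=
  ∃ u : (Fin n → ℤ) → 𝓢(Rn n, ℂ), (∀ k, eLpNorm (u k) p volume ≤ c k) ∧
    v = ∑ k ∈ F, smoothBlock k (u k)

variable {c : (Fin n → ℤ) → ℝ≥0∞} {F G : Finset (Fin n → ℤ)} {v w : 𝓢(Rn n, ℂ)}

theorem IsBlockSum.translate (h : IsBlockSum p c F v) (x : Rn n) :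
    IsBlockSum p c F (SchwartzMap.compSubConstCLM ℂ x v) := by
  obtain ⟨u, hu, rfl⟩ := h
  refine ⟨fun k => SchwartzMap.compSubConstCLM ℂ x (u k), fun k => ?_, ?_⟩
  · rw [eLpNorm_compSubConst]; exact hu k
  · simp only [map_sum, smoothBlock_compSubConst]

theorem IsBlockSum.add (h : IsBlockSum p c F v) (h' : IsBlockSum p c G w) (hFG : Disjoint F G) :
    IsBlockSum p c (F ∪ G) (v + w) := by
  classical
  obtain ⟨u, hu, rfl⟩ := h
  obtain ⟨u', hu', rfl⟩ := h'
  refine ⟨fun k => if k ∈ F then u k else u' k, fun k => ?_, ?_⟩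
  · dsimp only
    split_ifs
    exacts [hu k, hu' k]
  · rw [Finset.sum_union hFG]
    congr 1
    · exact Finset.sum_congr rfl fun k hk => by simp only [if_pos hk]
    · exact Finset.sum_congr rfl fun k hk => by simp only [if_neg (Finset.disjoint_right.1 hFG hk)]

variable [hp : Fact (1 ≤ p)]

theorem exists_isBlockSum_approx (hp' : p ≠ ∞) {b : (Fin n → ℤ) → Lp ℂ p (volume : Measure (Rn n))}
    (hb : ∀ k, lpSmoothBlock p k (b k) = b k) (F : Finset (Fin n → ℤ)) {ε : ℝ} (hε : 0 < ε) :
    ∃ v, IsBlockSum p (fun k => 2 * ‖b k‖ₑ) F v ∧ ‖v.toLp p volume - ∑ k ∈ F, b k‖ < ε := by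
  have hF : (0 : ℝ) < F.card + 1 := by positivity
  choose u hu hub using fun k => exists_smoothBlock_approx hp' (hb k) (div_pos hε hF)
  refine ⟨_, ⟨u, hu, rfl⟩, ?_⟩
  rw [← SchwartzMap.toLpCLM_apply (𝕜 := ℂ), map_sum, ← Finset.sum_sub_distrib]
  calc _ ≤ ∑ k ∈ F, ‖(smoothBlock k (u k)).toLp p volume - b k‖ := norm_sum_le _ _
    _ ≤ ∑ _k ∈ F, ε / (F.card + 1) := Finset.sum_le_sum fun k _ => (hub k).le
    _ = ε * (F.card / (F.card + 1)) := by rw [Finset.sum_const, nsmul_eq_mul]; ring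
    _ < ε := mul_lt_of_lt_one_right hε ((div_lt_one hF).2 (lt_add_one _))

/-- Uniformly bounded block sums leave no room for infinitely many non-negligible groups: such
groups could be translated far apart, making the norm of their sum unbounded. -/
theorem summable_of_isBlockSum_bounded (hn : 1 ≤ n) (hp' : p ≠ ∞)
    {b : (Fin n → ℤ) → Lp ℂ p (volume : Measure (Rn n))} (hb : ∀ k, lpSmoothBlock p k (b k) = b k)
    {M : ℝ≥0} (hM : ∀ F v, IsBlockSum p (fun k => 2 * ‖b k‖ₑ) F v → eLpNorm v p volume ≤ M) :
    Summable b := by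
  classical
  have hp0 : p ≠ 0 := (zero_lt_one.trans_le hp.out).ne'
  set r := p.toReal with hr
  have hr0 : 0 < r := ENNReal.toReal_pos hp0 hp'
  rw [summable_iff_vanishing_norm]
  by_contra! hc
  obtain ⟨δ, hδ, hc⟩ := hc
  -- A group of norm at least `δ`, approximated within `δ / 2`, still has norm above `δ / 2`.
  set c₀ : ℝ≥0∞ := ENNReal.ofReal (δ / 2) ^ r with hc₀
  have hc0 : c₀ ≠ 0 := by
    rw [hc₀, Ne, ENNReal.rpow_eq_zero_iff_of_pos hr0, ENNReal.ofReal_eq_zero, not_le]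
    positivity
  have hpow : ∀ v : 𝓢(Rn n, ℂ), ∫⁻ y, ‖v y‖ₑ ^ r = eLpNorm v p volume ^ r := fun v => by
    rw [eLpNorm_eq_lintegral_rpow_enorm_toReal hp0 hp', ← ENNReal.rpow_mul, ← hr,
      one_div_mul_cancel hr0.ne', ENNReal.rpow_one]
  have hstep : ∀ s : Finset (Fin n → ℤ), ∃ t v, Disjoint s t ∧
      IsBlockSum p (fun k => 2 * ‖b k‖ₑ) t v ∧ c₀ < ∫⁻ y, ‖v y‖ₑ ^ r := by
    intro s
    obtain ⟨t, hts, ht⟩ := hc s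
    obtain ⟨v, hv, hvt⟩ := exists_isBlockSum_approx hp' hb t (half_pos hδ)
    refine ⟨t, v, hts.symm, hv, ?_⟩
    rw [hpow, hc₀]
    refine ENNReal.rpow_lt_rpow ?_ hr0
    have h1 : δ / 2 < ‖v.toLp p volume‖ := by
      have := norm_sub_norm_le (∑ k ∈ t, b k) (v.toLp p volume)
      rw [norm_sub_rev] at this
      linarith
    rw [← enorm_toLp, ← ofReal_norm]
    exact (ENNReal.ofReal_lt_ofReal_iff (by linarith)).2 h1
  -- Each new group has fresh indices, so the prescribed block sizes persist, and it is moved far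
  -- enough in space to add at least `c₀` to the integral.
  have hgrow : ∀ N : ℕ, ∃ F v, IsBlockSum p (fun k => 2 * ‖b k‖ₑ) F v ∧
      ((N + 1 : ℕ) : ℝ≥0∞) * c₀ < ∫⁻ y, ‖v y‖ₑ ^ r := by
    intro N
    induction N with
    | zero =>
      obtain ⟨t, v, -, hv, h⟩ := hstep ∅
      exact ⟨t, v, hv, by simpa using h⟩
    | succ N ih =>
      obtain ⟨F, v, hv, h⟩ := ih
      obtain ⟨t, w, hd, hw, h'⟩ := hstep F
      obtain ⟨x, hx⟩ := exists_lt_lintegral_add_translate hn hr0 h h'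
      refine ⟨F ∪ t, _, hv.add (hw.translate x) hd, lt_of_eq_of_lt ?_ hx⟩
      push_cast
      ring
  obtain ⟨N, hN⟩ := ENNReal.exists_nat_mul_gt hc0
    (ENNReal.rpow_ne_top_of_nonneg hr0.le (ENNReal.coe_ne_top (r := M)))
  obtain ⟨F, v, hv, h⟩ := hgrow N
  rw [hpow] at h
  have h1 : eLpNorm v p volume ^ r ≤ (M : ℝ≥0∞) ^ r := ENNReal.rpow_le_rpow (hM F v hv) hr0.le
  have h2 : (N : ℝ≥0∞) * c₀ ≤ ((N + 1 : ℕ) : ℝ≥0∞) * c₀ := by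
    gcongr; simp
  exact lt_irrefl _ (hN.trans_le (h2.trans (h.le.trans h1)))

theorem enorm_tsum_le {ι E : Type*} [NormedAddCommGroup E] {b : ι → E} (hb : Summable b) {M : ℝ≥0∞}
    (hM : ∀ F : Finset ι, ‖∑ k ∈ F, b k‖ₑ ≤ M) : ‖∑' k, b k‖ₑ ≤ M :=
  le_of_tendsto hb.hasSum.enorm (Eventually.of_forall hM)

/-- For `p = ∞` the blocks converge absolutely by the `ℓ¹` bound. For `p < ∞` block sums are bounded
uniformly in the finite index set, which gives both unconditional summability and, after
approximation, the norm estimate. -/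
theorem SchwartzEmbedsLp.exists_summable (hn : 1 ≤ n) {q : ℝ≥0∞} (hq : 1 ≤ q) {s : ℝ}
    {φ : 𝓢(Rn n, ℂ)} (hφ : IsWindow φ) (h : SchwartzEmbedsLp φ p q s) :
    ∃ A : ℝ≥0, ∀ f ∈ modSpace φ p q s, ∃ b : (Fin n → ℤ) → Lp ℂ p (volume : Measure (Rn n)),
      (∀ k, (b k : 𝓢'(Rn n, ℂ)) = freqBlock φ k f) ∧ Summable b ∧
      ‖∑' k, b k‖ₑ ≤ A * modNorm φ p q s f := by
  rcases eq_or_ne p ∞ with rfl | hp'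
  · obtain ⟨A, hA⟩ := h.exists_sum_le_of_top hq hφ
    refine ⟨A, fun f hf => ?_⟩
    obtain ⟨b, hb, hbn⟩ := exists_lp_blocks hq hf
    have h1 : ∀ F : Finset (Fin n → ℤ), ∑ k ∈ F, ‖b k‖ₑ ≤ A * modNorm φ ∞ q s f := fun F => by
      rw [hbn]; exact hA F fun k => ‖b k‖₊
    have h2 : ∑' k, ‖b k‖ₑ ≤ A * modNorm φ ∞ q s f := by
      rw [ENNReal.tsum_eq_iSup_sum]; exact iSup_le h1
    have h3 : Summable b := by
      refine Summable.of_nnnorm (ENNReal.tsum_coe_ne_top_iff_summable.1 ?_)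
      exact (h2.trans_lt (ENNReal.mul_lt_top ENNReal.coe_lt_top hf)).ne
    exact ⟨b, hb, h3, enorm_tsum_le h3 fun F => (enorm_sum_le _ _).trans (h1 F)⟩
  · obtain ⟨A, hA⟩ := h.exists_eLpNorm_sum_le hq hφ
    refine ⟨A * 2, fun f hf => ?_⟩
    obtain ⟨b, hb, hbn⟩ := exists_lp_blocks hq hf
    have hself : ∀ k, lpSmoothBlock p k (b k) = b k := fun k => lpSmoothBlock_eq_self hp' hφ (hb k)
    have h1 : ∀ F v, IsBlockSum p (fun k => 2 * ‖b k‖ₑ) F v →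
        eLpNorm v p volume ≤ (A * 2 : ℝ≥0) * modNorm φ p q s f := by
      rintro F v ⟨u, hu, rfl⟩
      refine (hA F u).trans ?_
      rw [ENNReal.coe_mul, mul_assoc, hbn, ENNReal.coe_ofNat]
      refine mul_le_mul_right ?_ _
      rw [← seqNorm_const_mul hq]
      refine seqNorm_mono fun k => ?_
      rw [mul_left_comm]
      exact mul_le_mul_right (hu k) _
    have hfin : ((A * 2 : ℝ≥0) : ℝ≥0∞) * modNorm φ p q s f ≠ ∞ :=
      (ENNReal.mul_lt_top ENNReal.coe_lt_top hf).ne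
    have h2 : Summable b := by
      refine summable_of_isBlockSum_bounded hn hp' hself
        (M := (((A * 2 : ℝ≥0) : ℝ≥0∞) * modNorm φ p q s f).toNNReal) fun F v hv => ?_
      rw [ENNReal.coe_toNNReal hfin]
      exact h1 F v hv
    refine ⟨b, hb, h2, enorm_tsum_le h2 fun F => ?_⟩
    refine ENNReal.le_of_forall_pos_le_add fun ε hε _ => ?_
    obtain ⟨v, hv, hvF⟩ := exists_isBlockSum_approx hp' hself F (NNReal.coe_pos.2 hε)
    have h3 := h1 F v hv
    rw [← enorm_toLp] at h3
    calc ‖∑ k ∈ F, b k‖ₑ = ‖v.toLp p volume - (v.toLp p volume - ∑ k ∈ F, b k)‖ₑ := by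
          rw [sub_sub_cancel]
      _ ≤ ‖v.toLp p volume‖ₑ + ‖v.toLp p volume - ∑ k ∈ F, b k‖ₑ := enorm_sub_le
      _ ≤ _ := by
          refine add_le_add h3 ?_
          rw [enorm_eq_nnnorm]
          exact_mod_cast hvF.le

end Summability

/-! ### Density of compactly supported Schwartz functions -/

section Density

variable {n : ℕ}

theorem exists_schwartz_eq_one_near_zero (n : ℕ) :
    ∃ κ : 𝓢(Rn n, ℂ), HasCompactSupport κ ∧ ∀ x, ‖x‖ < 1 → κ x = 1 := by
  let ρ : ContDiffBump (0 : Rn n) := ⟨1, 2, one_pos, one_lt_two⟩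
  have hc : HasCompactSupport (Complex.ofRealCLM ∘ ρ) := ρ.hasCompactSupport.comp_left rfl
  refine ⟨hc.toSchwartzMap (Complex.ofRealCLM.contDiff.comp ρ.contDiff), hc, fun x hx => ?_⟩
  change ((ρ x : ℝ) : ℂ) = 1
  rw [ρ.one_of_mem_closedBall (by simpa using hx.le)]
  simp

theorem norm_iteratedFDeriv_one_sub_comp_smul_le (κ : 𝓢(Rn n, ℂ)) (i : ℕ) {t : ℝ} (ht0 : 0 ≤ t)
    (ht1 : t ≤ 1) (x : Rn n) :
    ‖iteratedFDeriv ℝ i (fun y => 1 - κ (t • y)) x‖ ≤ 1 + SchwartzMap.seminorm ℝ 0 i κ := by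
  have h1 : ContDiff ℝ i (fun y : Rn n => 1 - κ y) := contDiff_const.sub (κ.smooth i)
  rw [iteratedFDeriv_comp_const_smul t h1, norm_smul, norm_pow, Real.norm_of_nonneg ht0]
  have h2 : ‖iteratedFDeriv ℝ i (fun y : Rn n => 1 - κ y) (t • x)‖
      ≤ 1 + SchwartzMap.seminorm ℝ 0 i κ := by
    have h3 : (fun y : Rn n => 1 - κ y) = (fun _ : Rn n => (1 : ℂ)) - (κ : Rn n → ℂ) := rfl
    rw [h3, iteratedFDeriv_sub_apply contDiff_const.contDiffAt (κ.smooth i).contDiffAt]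
    refine (norm_sub_le _ _).trans (add_le_add ?_ ?_)
    · rcases Nat.eq_zero_or_pos i with rfl | hi
      · simp
      · rw [iteratedFDeriv_const_of_ne hi.ne']; simp
    · simpa using κ.le_seminorm ℝ 0 i (t • x)
  calc _ ≤ 1 * (1 + SchwartzMap.seminorm ℝ 0 i κ) :=
        mul_le_mul (pow_le_one₀ ht0 ht1) h2 (norm_nonneg _) zero_le_one
    _ = _ := one_mul _

theorem iteratedFDeriv_one_sub_comp_smul_eq_zero {κ : 𝓢(Rn n, ℂ)} (hκ : ∀ x, ‖x‖ < 1 → κ x = 1)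
    (i : ℕ) {t : ℝ} {x : Rn n} (hx : ‖t • x‖ < 1) :
    iteratedFDeriv ℝ i (fun y => 1 - κ (t • y)) x = 0 := by
  have h : (fun y => 1 - κ (t • y)) =ᶠ[𝓝 x] fun _ => 0 := by
    have : ∀ᶠ y in 𝓝 x, ‖t • y‖ < 1 :=
      (continuous_const_smul t).norm.continuousAt.eventually (gt_mem_nhds hx)
    filter_upwards [this] with y hy
    rw [hκ _ hy, sub_self]
  rw [Filter.EventuallyEq.eq_of_nhds (Filter.EventuallyEq.iteratedFDeriv ℝ h i)]
  simp

theorem hasTemperateGrowth_comp_smul (κ : 𝓢(Rn n, ℂ)) (t : ℝ) :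
    Function.HasTemperateGrowth fun y => κ (t • y) :=
  κ.hasTemperateGrowth.comp (by fun_prop : Function.HasTemperateGrowth fun y : Rn n => t • y)

/-- All derivatives of `1 - κ(t ·)` vanish where `t‖x‖ < 1`; elsewhere `1 ≤ t‖x‖`, so one more power
of `‖x‖` in the seminorm of `w` buys a factor `t`. -/
theorem exists_seminorm_cutoff_sub_le {κ : 𝓢(Rn n, ℂ)} (hκ : ∀ x, ‖x‖ < 1 → κ x = 1)
    (w : 𝓢(Rn n, ℂ)) (k j : ℕ) :
    ∃ C : ℝ, ∀ t : ℝ, 0 < t → t ≤ 1 →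
      SchwartzMap.seminorm ℝ k j (SchwartzMap.smulLeftCLM ℂ (fun y => κ (t • y)) w - w) ≤ C * t := by
  refine ⟨∑ i ∈ Finset.range (j + 1), (j.choose i : ℝ) * (1 + SchwartzMap.seminorm ℝ 0 i κ) *
    SchwartzMap.seminorm ℝ (k + 1) (j - i) w, fun t ht0 ht1 => ?_⟩
  refine SchwartzMap.seminorm_le_bound ℝ k j _ (by positivity) fun x => ?_
  set h : Rn n → ℂ := fun y => 1 - κ (t • y) with hh
  have h0 : ((SchwartzMap.smulLeftCLM ℂ (fun y => κ (t • y)) w - w : 𝓢(Rn n, ℂ)) : Rn n → ℂ)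
      = -fun y => h y * w y := by
    ext y
    rw [sub_apply, SchwartzMap.smulLeftCLM_apply_apply (hasTemperateGrowth_comp_smul κ t)]
    simp only [Pi.neg_apply, hh, smul_eq_mul]
    ring
  have hs : ContDiff ℝ j h :=
    contDiff_const.sub ((κ.smooth j).comp (contDiff_const_smul t))
  rw [h0, iteratedFDeriv_neg_apply, norm_neg]
  have h1 := norm_iteratedFDeriv_mul_le hs (w.smooth j) x (n := j) le_rfl
  calc _ ≤ ‖x‖ ^ k * _ := mul_le_mul_of_nonneg_left h1 (by positivity)
    _ ≤ _ := ?_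
  rw [Finset.mul_sum, Finset.sum_mul]
  refine Finset.sum_le_sum fun i _ => ?_
  by_cases hx : ‖t • x‖ < 1
  · rw [hh, iteratedFDeriv_one_sub_comp_smul_eq_zero hκ i hx]
    simp only [norm_zero, mul_zero, zero_mul]
    positivity
  · have h2 : 1 ≤ t * ‖x‖ := by
      rwa [not_lt, norm_smul, Real.norm_of_nonneg ht0.le] at hx
    have h3 := norm_iteratedFDeriv_one_sub_comp_smul_le κ i ht0.le ht1 x
    have h4 := w.le_seminorm ℝ (k + 1) (j - i) x
    calc ‖x‖ ^ k * ((j.choose i : ℝ) * ‖iteratedFDeriv ℝ i h x‖ * ‖iteratedFDeriv ℝ (j - i) w x‖)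
        = (j.choose i : ℝ) * ‖iteratedFDeriv ℝ i h x‖ *
          (1 * ‖x‖ ^ k * ‖iteratedFDeriv ℝ (j - i) w x‖) := by ring
      _ ≤ (j.choose i : ℝ) * (1 + SchwartzMap.seminorm ℝ 0 i κ) *
          (t * ‖x‖ * ‖x‖ ^ k * ‖iteratedFDeriv ℝ (j - i) w x‖) := by gcongr
      _ = (j.choose i : ℝ) * (1 + SchwartzMap.seminorm ℝ 0 i κ) *
          (‖x‖ ^ (k + 1) * ‖iteratedFDeriv ℝ (j - i) w x‖) * t := by ring
      _ ≤ _ := by gcongr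

theorem tendsto_cutoff {κ : 𝓢(Rn n, ℂ)} (hκ : ∀ x, ‖x‖ < 1 → κ x = 1) (w : 𝓢(Rn n, ℂ)) :
    Tendsto (fun t : ℝ => SchwartzMap.smulLeftCLM ℂ (fun y => κ (t • y)) w) (𝓝[>] 0) (𝓝 w) := by
  rw [(schwartz_withSeminorms ℝ (Rn n) ℂ).tendsto_nhds]
  rintro ⟨k, j⟩ ε hε
  obtain ⟨C, hC⟩ := exists_seminorm_cutoff_sub_le hκ w k j
  have h1 : Tendsto (fun t : ℝ => C * t) (𝓝[>] 0) (𝓝 0) := by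
    have : Continuous fun t : ℝ => C * t := by fun_prop
    simpa using (this.tendsto 0).mono_left nhdsWithin_le_nhds
  filter_upwards [h1.eventually (gt_mem_nhds hε), Ioc_mem_nhdsGT (zero_lt_one (α := ℝ))] with t h2 h3
  exact (hC t h3.1 h3.2).trans_lt h2

/-- Compactly supported Schwartz functions are dense. -/
theorem tempered_eq_of_hasCompactSupport {T S : 𝓢'(Rn n, ℂ)}
    (h : ∀ w : 𝓢(Rn n, ℂ), HasCompactSupport w → T w = S w) : T = S := by
  obtain ⟨κ, hκc, hκ⟩ := exists_schwartz_eq_one_near_zero n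
  ext w
  have hT := ((map_continuous T).tendsto w).comp (tendsto_cutoff hκ w)
  have hS := ((map_continuous S).tendsto w).comp (tendsto_cutoff hκ w)
  refine tendsto_nhds_unique (hT.congr' ?_) hS
  filter_upwards [self_mem_nhdsWithin] with t ht
  refine h _ ?_
  have h1 : HasCompactSupport fun y : Rn n => κ (t • y) := hκc.comp_smul (ne_of_gt ht)
  have h2 : ((SchwartzMap.smulLeftCLM ℂ (fun y => κ (t • y)) w : 𝓢(Rn n, ℂ)) : Rn n → ℂ)
      = (fun y => κ (t • y)) * w := by
    ext y
    rw [SchwartzMap.smulLeftCLM_apply_apply (hasTemperateGrowth_comp_smul κ t)]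
    rfl
  rw [h2]
  exact h1.mul_right

end Density

/-! ### Recovering the distribution from its blocks -/

section Reconstruction

variable {n : ℕ}

/-- A compactly supported Schwartz function is the finite sum of its localisations. -/
theorem exists_sum_window_smul_eq {φ : 𝓢(Rn n, ℂ)} (hφ : IsWindow φ) {w : 𝓢(Rn n, ℂ)}
    (hw : HasCompactSupport w) :
    ∃ K : Finset (Fin n → ℤ),
      (∀ k ∉ K, SchwartzMap.smulLeftCLM ℂ (fun η : Rn n => φ ((2 * Real.pi) • η - latticePt k)) w = 0) ∧
      ∑ k ∈ K, SchwartzMap.smulLeftCLM ℂ (fun η : Rn n => φ ((2 * Real.pi) • η - latticePt k)) w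
        = w := by
  obtain ⟨R, hR⟩ := hw.isBounded.exists_norm_le
  -- If the cube of `k` meets the support of `w`, then `|k i| ≤ 2πR + 1`, the `1` being the
  -- half-side of the cube.
  set m : ℤ := ⌈2 * Real.pi * R + 1⌉ with hm
  set K : Finset (Fin n → ℤ) := Finset.Icc (fun _ => -m) (fun _ => m) with hK
  have hz : ∀ k ∉ K, ∀ η, φ ((2 * Real.pi) • η - latticePt k) * w η = 0 := by
    intro k hk η
    by_contra hne
    refine hk ?_
    have h1 : w η ≠ 0 := right_ne_zero_of_mul hne
    have h2 : η ∈ freqCell k := by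
      by_contra hc
      exact left_ne_zero_of_mul hne (hφ.eq_zero_of_notMem hc)
    have h3 : ‖η‖ ≤ R := hR η (subset_tsupport _ h1)
    have h4 : ∀ i, |(k i : ℝ)| ≤ m := by
      intro i
      have h5 := h2 i
      have h6 : |2 * Real.pi * η i| ≤ 2 * Real.pi * R := by
        rw [abs_mul, abs_of_pos Real.two_pi_pos]
        exact mul_le_mul_of_nonneg_left ((PiLp.norm_apply_le η i).trans h3) Real.two_pi_pos.le
      have h7 := Int.le_ceil (2 * Real.pi * R + 1)
      rw [abs_le] at h5 h6 ⊢
      constructor <;> linarith [h5.1, h5.2, h6.1, h6.2]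
    rw [hK, Finset.mem_Icc]
    constructor
    · intro i; exact_mod_cast (abs_le.1 (h4 i)).1
    · intro i; exact_mod_cast (abs_le.1 (h4 i)).2
  refine ⟨K, fun k hk => ?_, ?_⟩
  · ext η
    rw [SchwartzMap.smulLeftCLM_apply_apply (hasTemperateGrowth_window φ k), smul_eq_mul, hz k hk]
    rfl
  · ext η
    rw [sum_apply]
    simp only [SchwartzMap.smulLeftCLM_apply_apply (hasTemperateGrowth_window φ _), smul_eq_mul]
    have h1 := (hφ.hasSum_translates ((2 * Real.pi) • η)).mul_right (w η)
    rw [one_mul] at h1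
    exact (hasSum_sum_of_ne_finset_zero fun k hk => hz k hk η).unique h1

/-- Convergence in `L^p` implies convergence as distributions. Tested on the Fourier side against a
compactly supported `w`, only finitely many blocks contribute, and the partition of unity
reassembles `w`; density of such `w` suffices. -/
theorem coe_tsum_lp_blocks {p : ℝ≥0∞} [Fact (1 ≤ p)] {φ : 𝓢(Rn n, ℂ)} (hφ : IsWindow φ)
    {f : 𝓢'(Rn n, ℂ)} {b : (Fin n → ℤ) → Lp ℂ p (volume : Measure (Rn n))}
    (hb : ∀ k, (b k : 𝓢'(Rn n, ℂ)) = freqBlock φ k f) (hs : Summable b) :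
    ((∑' k, b k : Lp ℂ p (volume : Measure (Rn n))) : 𝓢'(Rn n, ℂ)) = f := by
  set g := ∑' k, b k with hg
  have h0 : 𝓕 (g : 𝓢'(Rn n, ℂ)) = 𝓕 f := by
    refine tempered_eq_of_hasCompactSupport fun w hw => ?_
    rw [TemperedDistribution.fourier_apply, TemperedDistribution.fourier_apply]
    obtain ⟨K, hK, hsum⟩ := exists_sum_window_smul_eq hφ hw
    have hbk : ∀ k, (b k : 𝓢'(Rn n, ℂ)) (𝓕 w) = f (𝓕 (SchwartzMap.smulLeftCLM ℂ
        (fun η : Rn n => φ ((2 * Real.pi) • η - latticePt k)) w)) := fun k => by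
      rw [hb, freqBlock, TemperedDistribution.fourierMultiplierCLM_apply_apply,
        FourierTransform.fourierInv_fourier_eq]
    have h1 : HasSum (fun k => (b k : 𝓢'(Rn n, ℂ)) (𝓕 w)) ((g : 𝓢'(Rn n, ℂ)) (𝓕 w)) := by
      have h2 := hs.hasSum.mapL (Lp.toTemperedDistributionCLM ℂ (volume : Measure (Rn n)) p)
      exact h2.mapL (PointwiseConvergenceCLM.evalCLM (RingHom.id ℂ) ℂ (𝓕 w))
    have h2 : HasSum (fun k => (b k : 𝓢'(Rn n, ℂ)) (𝓕 w)) (∑ k ∈ K, (b k : 𝓢'(Rn n, ℂ)) (𝓕 w)) :=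
      hasSum_sum_of_ne_finset_zero fun k hk => by
        rw [hbk, hK k hk, FourierTransform.fourier_zero, map_zero]
    rw [h1.unique h2]
    simp only [hbk]
    rw [← map_sum, ← FourierTransform.fourier_sum, hsum]
  exact (FourierTransform.fourierEquiv ℂ 𝓢'(Rn n, ℂ)).injective h0

theorem modEmbedsLp_of_schwartzEmbedsLp (hn : 1 ≤ n) {p q : ℝ≥0∞} [Fact (1 ≤ p)] (hq : 1 ≤ q)
    {s : ℝ} {φ : 𝓢(Rn n, ℂ)} (hφ : IsWindow φ) (h : SchwartzEmbedsLp φ p q s) :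
    ModEmbedsLp φ p q s := by
  obtain ⟨A, hA⟩ := h.exists_summable hn hq hφ
  refine ⟨A, fun f hf => ?_⟩
  obtain ⟨b, hb, hs, hle⟩ := hA f hf
  exact ⟨∑' k, b k, coe_tsum_lp_blocks hφ hb hs, hle⟩

end Reconstruction

end ModulationSpace

theorem mainTheorem6 (n : ℕ) (hn : 1 ≤ n) (p q : ℝ≥0∞) [Fact (1 ≤ p)] (hq : 1 ≤ q)
    (s α : ℝ) (hα₀ : 0 ≤ α) (hα₂ : α ≤ 2)
    (φ : 𝓢(ModulationSpace.Rn n, ℂ)) (hφ : ModulationSpace.IsWindow φ) :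
    ModulationSpace.ExpMultiplierBounded φ α p q s ↔ ModulationSpace.ModEmbedsLp φ p q s := by
  constructor
  · intro h
    exact ModulationSpace.modEmbedsLp_of_schwartzEmbedsLp hn hq hφ
      (ModulationSpace.schwartzEmbedsLp_of_expMultiplierBounded hq s α hα₀ hα₂ hφ h)
  · intro h
    exact ModulationSpace.expMultiplierBounded_of_schwartzEmbedsLp hq s α hα₀ hα₂ hφ
      (ModulationSpace.schwartzEmbedsLp_of_modEmbedsLp h)
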